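/- Let $M$ be a smooth manifold of finite dimension, let $A\subset TM\setminus\mathbf 0$ be an open subset of $TM$ with $\pi(A)=M$ and $\lambda v\in A$ for all $v\in A$, $\lambda>0$, and let $L:A\to\mathbb R$ be a pseudo-Finsler metric: $L$ is smooth, $L(\lambda v)=\lambda^2L(v)$ for $v\in A$, $\lambda>0$, and for every $v\in A$ the fundamental tensor $g_v(u,w)=\frac12\frac{\partial^2}{\partial t\,\partial s}L(v+tu+sw)|_{t=s=0}$ ($u,w\in T_{\pi(v)}M$) is nondegenerate. Let $C_v(w_1,w_2,w_3)=\frac14\frac{\partial^3}{\partial s_3\partial s_2\partial s_1}L(v+\sum_i s_iw_i)|_{s_i=0}$ be the Cartan tensor. For a smooth vector field $V$ on an open set $\Omega\subset M$ with values in $A$, the Chern connection $\nabla^V$ is the affine connection on $\Omega$ with $\nabla^V_XY-\nabla^V_YX=[X,Y]$ and $X(g_V(Y,Z))=g_V(\nabla^V_XY,Z)+g_V(Y,\nabla^V_XZ)+2C_V(\nabla^V_XV,Y,Z)$ for all smooth $X,Y,Z$ on $\Omega$. In a chart, its Christoffel symbols are functions $\Gamma^k_{ij}(V(p))$ of the vector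 $V(p)\in A$, and for a curve $\gamma$ and vector fields $U,X$ along $\gamma$, with $U$ taking values in $A$, $D^U_\gamma X$ denotes the vector field along $\gamma$ with components $\dot X^k+\sum_{i,j}X^i\dot\gamma^j\,\Gamma^k_{ij}(U)$. The Legendre map is $\mathscr L_L(v)(w)=g_v(v,w)$ for $v\in A$, $w\in T_{\pi(v)}M$. The energy of a piecewise smooth curve $c:[a,b]\to M$ with velocities in $A$ is $E(c)=\frac12\int_a^bL(\dot c)\,dt$. Let $a=t_0<t_1<\dots<t_h<t_{h+1}=b$, let $\varepsilon>0$, and let $\Lambda:[a,b]\times(-\varepsilon,\varepsilon)\to M$ be a piecewise smooth variation of $\gamma=\Lambda(\cdot,0)$ with these breaks, that is, $\Lambda$ is smooth on each $[t_i,t_{i+1}]\times(-\varepsilon,\varepsilon)$. Write $\gamma_s=\Lambda(\cdot,s)$ and $W(t)=\frac{\partial\Lambda}{\partial s}(t,0)$. Assume that $\Lambda$ is $L$-admissible: for every $s\in(-\varepsilon,\varepsilon)$ all velocities of $\gamma_s$, including the one-sided velocities at the breaks and at the endpoints, lie in $A$. Then $L(\dot\gamma_s)$ (for every $s\in(-\varepsilon,\varepsilon)$)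 and $g_{\dot\gamma}(W,D^{\dot\gamma}_\gamma\dot\gamma)$ are integrable on $[a,b]$, the function $s\mapsto E(\gamma_s)$ is differentiable at $s=0$, and $$\frac{d}{ds}E(\gamma_s)\Big|_{s=0}=-\int_a^b g_{\dot\gamma}(W,D^{\dot\gamma}_\gamma\dot\gamma)\,dt+\big[g_{\dot\gamma}(W,\dot\gamma)\big]_a^b+\sum_{i=1}^h\big(\mathscr L_L(\dot\gamma(t_i^-))-\mathscr L_L(\dot\gamma(t_i^+))\big)(W(t_i)),$$ where $\dot\gamma(t_i^-)$ and $\dot\gamma(t_i^+)$ are the left and right velocities at the break $t_i$, and in the boundary term $\dot\gamma(a)$, $\dot\gamma(b)$ are the one-sided velocities. -/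

import Mathlib

open Set MeasureTheory
open scoped Manifold ContDiff Topology Bundle

noncomputable section

namespace PseudoFinsler

variable {E : Type*} [NormedAddCommGroup E] [NormedSpace ℝ E] [FiniteDimensional ℝ E]
  {M : Type*} [TopologicalSpace M] [ChartedSpace E M] [IsManifold 𝓘(ℝ, E) ∞ M]

/-- The fundamental tensor `g_v(u, w) = ½ ∂²/∂t∂s L(v + t u + s w)` at `t = s = 0` of a function
`L` on the tangent bundle, for `v, u, w ∈ T_p M`. -/
def fundamentalTensor (L : TangentBundle 𝓘(ℝ, E) M → ℝ) {p : M}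
    (v u w : TangentSpace 𝓘(ℝ, E) p) : ℝ :=
  (1 / 2) * deriv (fun t : ℝ => deriv (fun s : ℝ => L ⟨p, v + t • u + s • w⟩) 0) 0

/-- The Cartan tensor `C_v(w₁, w₂, w₃) = ¼ ∂³/∂s₃∂s₂∂s₁ L(v + s₁ w₁ + s₂ w₂ + s₃ w₃)` at
`s₁ = s₂ = s₃ = 0`. -/
def cartanTensor (L : TangentBundle 𝓘(ℝ, E) M → ℝ) {p : M}
    (v w₁ w₂ w₃ : TangentSpace 𝓘(ℝ, E) p) : ℝ :=
  (1 / 4) * deriv (fun s₃ : ℝ => deriv (fun s₂ : ℝ => deriv (fun s₁ : ℝ =>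
    L ⟨p, v + s₁ • w₁ + s₂ • w₂ + s₃ • w₃⟩) 0) 0) 0

end PseudoFinsler

open PseudoFinsler in
/-- A (conic, two-homogeneous) pseudo-Finsler metric on the manifold `M`: a smooth function on an
open conic subset `A` of the slit tangent bundle with `π(A) = M`. The function `L` is total in
Lean, but only its values on `A` are constrained. -/
structure PseudoFinslerMetric (E : Type*) [NormedAddCommGroup E] [NormedSpace ℝ E]
    [FiniteDimensional ℝ E] (M : Type*) [TopologicalSpace M] [ChartedSpace E M]
    [IsManifold 𝓘(ℝ, E) ∞ M] where
  /-- the domain of the metric -/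
  A : Set (TangentBundle 𝓘(ℝ, E) M)
  /-- the metric -/
  L : TangentBundle 𝓘(ℝ, E) M → ℝ
  isOpen_A : IsOpen A
  ne_zero_of_mem : ∀ (p : M) (v : TangentSpace 𝓘(ℝ, E) p), (⟨p, v⟩ : TangentBundle 𝓘(ℝ, E) M) ∈ A →
    v ≠ 0
  exists_mem : ∀ p : M, ∃ v : TangentSpace 𝓘(ℝ, E) p, (⟨p, v⟩ : TangentBundle 𝓘(ℝ, E) M) ∈ A
  smul_mem : ∀ (p : M) (v : TangentSpace 𝓘(ℝ, E) p) (c : ℝ), 0 < c →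
    (⟨p, v⟩ : TangentBundle 𝓘(ℝ, E) M) ∈ A → (⟨p, c • v⟩ : TangentBundle 𝓘(ℝ, E) M) ∈ A
  contMDiffOn_L : ContMDiffOn 𝓘(ℝ, E).tangent 𝓘(ℝ, ℝ) ∞ L A
  homogeneous : ∀ (p : M) (v : TangentSpace 𝓘(ℝ, E) p) (c : ℝ), 0 < c →
    (⟨p, v⟩ : TangentBundle 𝓘(ℝ, E) M) ∈ A → L ⟨p, c • v⟩ = c ^ 2 * L ⟨p, v⟩
  nondegenerate : ∀ (p : M) (v : TangentSpace 𝓘(ℝ, E) p),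
    (⟨p, v⟩ : TangentBundle 𝓘(ℝ, E) M) ∈ A → ∀ u : TangentSpace 𝓘(ℝ, E) p,
      (∀ w : TangentSpace 𝓘(ℝ, E) p, fundamentalTensor L v u w = 0) → u = 0

namespace PseudoFinsler

variable {E : Type*} [NormedAddCommGroup E] [NormedSpace ℝ E] [FiniteDimensional ℝ E]
  {M : Type*} [TopologicalSpace M] [ChartedSpace E M] [IsManifold 𝓘(ℝ, E) ∞ M]

/-- The field `X` is a smooth vector field on `Ω` (its values outside `Ω` are irrelevant). -/
def IsSmoothFieldOn (X : Π p : M, TangentSpace 𝓘(ℝ, E) p) (Ω : Set M) : Prop :=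
  ContMDiffOn 𝓘(ℝ, E) 𝓘(ℝ, E).tangent ∞
    (fun p => (⟨p, X p⟩ : TangentBundle 𝓘(ℝ, E) M)) Ω

/-- `cov` is the Chern connection `∇^V` on the open set `Ω` associated with the admissible vector
field `V` on `Ω`: a torsion-free, almost `g`-compatible affine connection on `Ω`.
In the notation of Mathlib, `cov Y p (X p)` is `(∇_X Y)(p)`. -/
structure IsChernConnection (F : PseudoFinslerMetric E M) (Ω : Set M)
    (V : Π p : M, TangentSpace 𝓘(ℝ, E) p)
    (cov : (Π p : M, TangentSpace 𝓘(ℝ, E) p) →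
      (Π p : M, TangentSpace 𝓘(ℝ, E) p →L[ℝ] TangentSpace 𝓘(ℝ, E) p)) : Prop where
  isCovariantDerivativeOn : IsCovariantDerivativeOn E cov Ω
  /-- `∇_X Y - ∇_Y X = [X, Y]` -/
  torsion_free : ∀ X Y : Π p : M, TangentSpace 𝓘(ℝ, E) p,
    IsSmoothFieldOn X Ω → IsSmoothFieldOn Y Ω → ∀ p ∈ Ω,
      cov Y p (X p) - cov X p (Y p) = VectorField.mlieBracket 𝓘(ℝ, E) X Y p
  /-- `X (g_V(Y, Z)) = g_V(∇_X Y, Z) + g_V(Y, ∇_X Z) + 2 C_V(∇_X V, Y, Z)` -/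
  almost_compatible : ∀ X Y Z : Π p : M, TangentSpace 𝓘(ℝ, E) p,
    IsSmoothFieldOn X Ω → IsSmoothFieldOn Y Ω → IsSmoothFieldOn Z Ω → ∀ p ∈ Ω,
      mfderiv 𝓘(ℝ, E) 𝓘(ℝ, ℝ) (fun q => fundamentalTensor F.L (V q) (Y q) (Z q)) p (X p) =
        fundamentalTensor F.L (V p) (cov Y p (X p)) (Z p) +
        fundamentalTensor F.L (V p) (Y p) (cov Z p (X p)) +
        2 * cartanTensor F.L (V p) (cov V p (X p)) (Y p) (Z p)

open Classical in
/-- The Chern connection `∇^V` on `Ω`. For an open set `Ω` and a smooth admissible field `V` on `Ω`,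
the properties in `IsChernConnection` determine it uniquely on smooth fields; the value `0` in the
other case is never meant. -/
def chernConnection (F : PseudoFinslerMetric E M) (Ω : Set M)
    (V : Π p : M, TangentSpace 𝓘(ℝ, E) p) :
    (Π p : M, TangentSpace 𝓘(ℝ, E) p) →
      (Π p : M, TangentSpace 𝓘(ℝ, E) p →L[ℝ] TangentSpace 𝓘(ℝ, E) p) :=
  if h : ∃ cov, IsChernConnection F Ω V cov then h.choose else 0

/-- The Christoffel symbols of the Chern connection at `w ∈ A ∩ T_p M`, in the preferred chart at
`p`, as the bilinear map `(x, u) ↦ ∑ xⁱ uʲ Γᵏᵢⱼ(w) ∂ₖ`. The value is `(∇^V_U X)(p)`, where `V`, `X`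
are the vector fields with constant coefficients in that chart that extend `w`, `x`, and
`U(p) = u`. The domain of `V` is the open set of those points of the chart at which `V` is
admissible. -/
def christoffel (F : PseudoFinslerMetric E M) {p : M} (w x u : TangentSpace 𝓘(ℝ, E) p) :
    TangentSpace 𝓘(ℝ, E) p :=
  chernConnection F
    {q | q ∈ (chartAt E p).source ∧
      (⟨q, FiberBundle.extend E w q⟩ : TangentBundle 𝓘(ℝ, E) M) ∈ F.A}
    (FiberBundle.extend E w) (FiberBundle.extend E x) p u

/-- The velocity `ċ(t)`. -/
def velocity (c : ℝ → M) (t : ℝ) : TangentSpace 𝓘(ℝ, E) (c t) :=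
  mfderiv 𝓘(ℝ, ℝ) 𝓘(ℝ, E) c t (1 : ℝ)

/-- The right velocity `ċ(t⁺)`. -/
def rightVelocity (c : ℝ → M) (t : ℝ) : TangentSpace 𝓘(ℝ, E) (c t) :=
  mfderivWithin 𝓘(ℝ, ℝ) 𝓘(ℝ, E) c (Ici t) t (1 : ℝ)

/-- The left velocity `ċ(t⁻)`. -/
def leftVelocity (c : ℝ → M) (t : ℝ) : TangentSpace 𝓘(ℝ, E) (c t) :=
  mfderivWithin 𝓘(ℝ, ℝ) 𝓘(ℝ, E) c (Iic t) t (1 : ℝ)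

/-- The covariant derivative `D^W_c X` along the curve `c` with reference field `W`, at the
parameter `t`. In the preferred chart at `c t` its components are
`Ẋᵏ + ∑ Xⁱ ċʲ Γᵏᵢⱼ(W)`. -/
def covDerivAlong (F : PseudoFinslerMetric E M) (c : ℝ → M)
    (W X : Π t : ℝ, TangentSpace 𝓘(ℝ, E) (c t)) (t : ℝ) : TangentSpace 𝓘(ℝ, E) (c t) :=
  letI e := trivializationAt E (TangentSpace 𝓘(ℝ, E) : M → Type _) (c t)
  e.symm (c t) (deriv (fun τ : ℝ => (e (⟨c τ, X τ⟩ : TangentBundle 𝓘(ℝ, E) M)).2) t) +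
    christoffel F (W t) (X t) (velocity c t)

/-- The Legendre transformation: `𝓛_L(v)` is the one-form `w ↦ g_v(v, w)`. -/
def legendre (F : PseudoFinslerMetric E M) {p : M} (v : TangentSpace 𝓘(ℝ, E) p) :
    TangentSpace 𝓘(ℝ, E) p → ℝ :=
  fun w => fundamentalTensor F.L v v w

/-- The piecewise smooth curve `c : [a, b] → M` is admissible: all its velocities, including the
one-sided ones at the breaks and at the endpoints, belong to `A`. -/
def IsAdmissibleCurve (F : PseudoFinslerMetric E M) (a b : ℝ) (c : ℝ → M) : Prop :=
  (∀ t ∈ Ico a b, (⟨c t, rightVelocity c t⟩ : TangentBundle 𝓘(ℝ, E) M) ∈ F.A) ∧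
  (∀ t ∈ Ioc a b, (⟨c t, leftVelocity c t⟩ : TangentBundle 𝓘(ℝ, E) M) ∈ F.A)

/-- The energy `½ ∫_a^b L(ċ) dt`. -/
def energy (F : PseudoFinslerMetric E M) (a b : ℝ) (c : ℝ → M) : ℝ :=
  (1 / 2) * ∫ t in a..b, F.L ⟨c t, velocity c t⟩

/-- `Λ : [a, b] × (-ε, ε) → M` is a piecewise smooth variation with breaks
`a = t₀ < t₁ < ⋯ < t_h < t_{h+1} = b`: it is smooth on every closed strip
`[t_i, t_{i+1}] × (-ε, ε)` (so in particular it is continuous on `[a, b] × (-ε, ε)`).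
Values of `Λ` outside `[a, b] × (-ε, ε)` are irrelevant. -/
structure IsPiecewiseSmoothVariation (E : Type*) [NormedAddCommGroup E] [NormedSpace ℝ E]
    {M : Type*} [TopologicalSpace M] [ChartedSpace E M]
    (a b ε : ℝ) {h : ℕ} (t : Fin (h + 2) → ℝ) (Λ : ℝ × ℝ → M) : Prop where
  pos : 0 < ε
  strictMono : StrictMono t
  first : t 0 = a
  last : t (Fin.last (h + 1)) = b
  smoothOn : ∀ i : Fin (h + 1), ContMDiffOn 𝓘(ℝ, ℝ × ℝ) 𝓘(ℝ, E) ∞ Λ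
    (Icc (t i.castSucc) (t i.succ) ×ˢ Ioo (-ε) ε)

/-- The longitudinal curve `γ_s = Λ(·, s)` of a variation. -/
abbrev longitudinal (Λ : ℝ × ℝ → M) (s : ℝ) : ℝ → M := fun t => Λ (t, s)

/-- The variational vector field `W(t) = ∂Λ/∂s (t, 0)` along `γ = γ_0`. -/
def variationField (Λ : ℝ × ℝ → M) (t : ℝ) : TangentSpace 𝓘(ℝ, E) (longitudinal Λ 0 t) :=
  mfderiv 𝓘(ℝ, ℝ) 𝓘(ℝ, E) (fun s : ℝ => Λ (t, s)) 0 (1 : ℝ)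

end PseudoFinsler

end

set_option linter.unusedSectionVars false

noncomputable section

namespace PseudoFinsler

/-! ### Iterated derivatives along lines and their symmetries -/

section Calculus

variable {G : Type*} [NormedAddCommGroup G] [NormedSpace ℝ G] {ℓ : G → ℝ} {O : Set G} {z : G}

/-! In a chart write ℓ(x, v) for `L`. The chain rule and ∂_s∂_t = ∂_t∂_s give ½ ∂_s ℓ(x, ẋ) = ∂_t(½
∂_vℓ · ∂_s x) − ½ (d/dt ∂_vℓ − ∂_xℓ) · ∂_s x, which is `fderiv_lagrangian_variation`. The theorem is
this identity integrated, once the two terms on the right are recognized as g(W, γ̇) and g(W, Dγ̇).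

Both recognitions rest on homogeneity. Euler's relation, differentiated in the fibre, gives g_v(v,
w) = ½ ∂_vℓ(w), which settles the first term. Differentiated again it gives C_v(v, ·, ·) = 0. Hence
the Cartan terms drop out of the Koszul computation of g_w(∇_W W, z) for the field W with constant
components extending w, and ½ (∂_x∂_vℓ(w, z) − ∂_xℓ(z)) remains
(`fundamentalTensor_christoffel_self`). Adding the acceleration part ½ ∂_v∂_vℓ(ẍ, z) yields half the
Euler–Lagrange expression.

The Koszul computation uses only the axioms of a Chern connection, so uniqueness plays no role.
Existence does, since `chernConnection` is 0 when no such connection exists: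
`exists_chern_christoffel` solves for the Christoffel symbols by linear algebra, and
`isChernConnection_chartConnection` turns them into a connection.

On each closed strip between consecutive breaks, L(∂_tΛ) and g(∂_sΛ, ∂_tΛ) are chart-free functions,
smooth up to the boundary. The identity is therefore checked at one interior point at a time, in the
chart at that point, and integrated over the whole strip without subdividing it by charts. Adding
the strips, the boundary terms at each interior break combine into the jump of the Legendre
transform. -/

lemma contDiffAt_fderiv {G' : Type*} [NormedAddCommGroup G'] [NormedSpace ℝ G'] {f : G → G'}
    (h : ContDiffAt ℝ ∞ f z) : ContDiffAt ℝ ∞ (fderiv ℝ f) z :=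
  h.fderiv_right (m := ∞) (by simp)

lemma fderiv_fderiv_symm {G' : Type*} [NormedAddCommGroup G'] [NormedSpace ℝ G'] {f : G → G'}
    (h : ContDiffAt ℝ ∞ f z) (a b : G) :
    fderiv ℝ (fderiv ℝ f) z a b = fderiv ℝ (fderiv ℝ f) z b a :=
  (h.isSymmSndFDerivAt (by simpa using WithTop.coe_le_coe.2 (le_top : (2 : ℕ∞) ≤ ⊤))) a b

lemma fderiv_clm_apply_const {G' : Type*} [NormedAddCommGroup G'] [NormedSpace ℝ G']
    {f : G → G →L[ℝ] G'} (h : DifferentiableAt ℝ f z) (a b : G) :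
    fderiv ℝ (fun y => f y b) z a = fderiv ℝ f z a b := by
  have := (h.hasFDerivAt.clm_apply (hasFDerivAt_const b z)).fderiv
  rw [this]; simp

/-- The Hessian is symmetric at every point of the open set `O`, and this identity may be
differentiated. With the exchange of the first two slots, which is `fderiv_fderiv_symm` for `fderiv
ℝ ℓ`, it generates all permutations. -/
lemma fderiv_fderiv_fderiv_symm (hO : IsOpen O) (hℓ : ContDiffOn ℝ ∞ ℓ O) (hz : z ∈ O) (a b c : G) :
    fderiv ℝ (fderiv ℝ (fderiv ℝ ℓ)) z a b c = fderiv ℝ (fderiv ℝ (fderiv ℝ ℓ)) z a c b := by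
  have h := hℓ.contDiffAt (hO.mem_nhds hz)
  have h2 := contDiffAt_fderiv (contDiffAt_fderiv h)
  have hd : DifferentiableAt ℝ (fderiv ℝ (fderiv ℝ ℓ)) z := h2.differentiableAt (by simp)
  have e1 : ∀ b c : G, fderiv ℝ (fun y => fderiv ℝ (fderiv ℝ ℓ) y b c) z a =
      fderiv ℝ (fderiv ℝ (fderiv ℝ ℓ)) z a b c := fun b c => by
    have := ((hd.hasFDerivAt.clm_apply (hasFDerivAt_const b z)).clm_apply
      (hasFDerivAt_const c z)).fderiv
    rw [this]; simp
  rw [← e1, ← e1]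
  congr 1
  apply Filter.EventuallyEq.fderiv_eq
  filter_upwards [hO.mem_nhds hz] with y hy using
    fderiv_fderiv_symm (hℓ.contDiffAt (hO.mem_nhds hy)) b c

lemma hasDerivAt_comp_line {G' : Type*} [NormedAddCommGroup G'] [NormedSpace ℝ G'] {f : G → G'}
    {w : G} {c : ℝ → G} {r : ℝ} (hc : HasDerivAt c w r)
    (hf : DifferentiableAt ℝ f (c r)) : deriv (fun s => f (c s)) r = fderiv ℝ f (c r) w :=
  (hf.hasFDerivAt.comp_hasDerivAt r hc).deriv

lemma hasDerivAt_add_smul (z w : G) (r : ℝ) : HasDerivAt (fun s : ℝ => z + s • w) w r := by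
  simpa using ((hasDerivAt_id r).smul_const w).const_add z

lemma tendsto_add_smul (z w : G) : Filter.Tendsto (fun s : ℝ => z + s • w) (𝓝 0) (𝓝 z) := by
  simpa using (hasDerivAt_add_smul z w 0).continuousAt.tendsto

/-- The inner derivative is known only while the base point stays in `O`, that is for `t` near 0,
which suffices for the outer derivative. -/
lemma deriv_deriv_line (hO : IsOpen O) (hℓ : ContDiffOn ℝ ∞ ℓ O) (hz : z ∈ O) (u w : G) :
    deriv (fun t : ℝ => deriv (fun s : ℝ => ℓ (z + t • u + s • w)) 0) 0 =
      fderiv ℝ (fderiv ℝ ℓ) z u w := by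
  have h := hℓ.contDiffAt (hO.mem_nhds hz)
  have ev : ∀ᶠ t in 𝓝 (0 : ℝ), deriv (fun s : ℝ => ℓ (z + t • u + s • w)) 0 =
      fderiv ℝ ℓ (z + t • u) w := by
    filter_upwards [(tendsto_add_smul z u).eventually (hO.mem_nhds hz)] with t ht
    have := hasDerivAt_comp_line (f := ℓ) (hasDerivAt_add_smul (z + t • u) w 0)
      (by simpa using (hℓ.contDiffAt (hO.mem_nhds ht)).differentiableAt (by simp))
    simpa using this
  rw [Filter.EventuallyEq.deriv_eq ev]
  have hd : DifferentiableAt ℝ (fderiv ℝ ℓ) z := (contDiffAt_fderiv h).differentiableAt (by simp)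
  have := hasDerivAt_comp_line (f := fun y => fderiv ℝ ℓ y w) (hasDerivAt_add_smul z u 0)
    (by simpa using hd.clm_apply (differentiableAt_const w))
  rw [this]
  simpa using fderiv_clm_apply_const hd u w

lemma deriv_deriv_deriv_line (hO : IsOpen O) (hℓ : ContDiffOn ℝ ∞ ℓ O) (hz : z ∈ O)
    (w₁ w₂ w₃ : G) :
    deriv (fun s₃ : ℝ => deriv (fun s₂ : ℝ => deriv (fun s₁ : ℝ =>
      ℓ (z + s₁ • w₁ + s₂ • w₂ + s₃ • w₃)) 0) 0) 0 =
      fderiv ℝ (fderiv ℝ (fderiv ℝ ℓ)) z w₁ w₂ w₃ := by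
  have h := hℓ.contDiffAt (hO.mem_nhds hz)
  have ev : ∀ᶠ t in 𝓝 (0 : ℝ), deriv (fun s₂ : ℝ => deriv (fun s₁ : ℝ =>
      ℓ (z + s₁ • w₁ + s₂ • w₂ + t • w₃)) 0) 0 = fderiv ℝ (fderiv ℝ ℓ) (z + t • w₃) w₂ w₁ := by
    filter_upwards [(tendsto_add_smul z w₃).eventually (hO.mem_nhds hz)] with t ht
    rw [← deriv_deriv_line hO hℓ ht]
    congr! 5
    abel_nf
  rw [Filter.EventuallyEq.deriv_eq ev]
  have hd : DifferentiableAt ℝ (fderiv ℝ (fderiv ℝ ℓ)) z :=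
    (contDiffAt_fderiv (contDiffAt_fderiv h)).differentiableAt (by simp)
  have := hasDerivAt_comp_line (f := fun y => fderiv ℝ (fderiv ℝ ℓ) y w₂ w₁)
    (hasDerivAt_add_smul z w₃ 0)
    (by simpa using
      (hd.clm_apply (differentiableAt_const w₂)).clm_apply (differentiableAt_const w₁))
  rw [this]
  have h2 := contDiffAt_fderiv h
  have e1 : fderiv ℝ (fun y => fderiv ℝ (fderiv ℝ ℓ) y w₂ w₁) z w₃ =
      fderiv ℝ (fderiv ℝ (fderiv ℝ ℓ)) z w₃ w₂ w₁ := by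
    have := ((hd.hasFDerivAt.clm_apply (hasFDerivAt_const w₂ z)).clm_apply
      (hasFDerivAt_const w₁ z)).fderiv
    rw [this]; simp
  have e0 : z + (0 : ℝ) • w₃ = z := by simp
  rw [e0, e1, fderiv_fderiv_fderiv_symm hO hℓ hz, fderiv_fderiv_symm h2 w₃ w₁,
    fderiv_fderiv_fderiv_symm hO hℓ hz]

end Calculus

/-! ### Consequences of two-homogeneity -/

section Homogeneous

variable {E : Type*} [NormedAddCommGroup E] [NormedSpace ℝ E] {ℓ : E × E → ℝ} {O : Set (E × E)}
  {z : E × E}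

/-- Euler's relation: the fibre derivative of a two-homogeneous function. -/
lemma fderiv_fiber_self (h : DifferentiableAt ℝ ℓ z)
    (hom : ∀ c : ℝ, 0 < c → ℓ (z.1, c • z.2) = c ^ 2 * ℓ z) :
    fderiv ℝ ℓ z (0, z.2) = 2 * ℓ z := by
  have h1 : HasDerivAt (fun c : ℝ => ((z.1, c • z.2) : E × E)) (0, z.2) 1 := by
    have := (hasDerivAt_const (1 : ℝ) z.1).prodMk ((hasDerivAt_id (1 : ℝ)).smul_const z.2)
    simpa using this
  have e : ((z.1, (1 : ℝ) • z.2) : E × E) = z := by simp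
  have := hasDerivAt_comp_line h1 (f := ℓ) (by rwa [e])
  rw [e] at this
  rw [← this]
  have ev : (fun c : ℝ => ℓ (z.1, c • z.2)) =ᶠ[𝓝 1] fun c => c ^ 2 * ℓ z := by
    filter_upwards [lt_mem_nhds (zero_lt_one (α := ℝ))] with c hc using hom c hc
  rw [ev.deriv_eq]
  have := ((hasDerivAt_pow 2 (1 : ℝ)).mul_const (ℓ z)).deriv
  rw [this]; norm_num

variable (hO : IsOpen O) (hℓ : ContDiffOn ℝ ∞ ℓ O)
  (hom : ∀ z ∈ O, ∀ c : ℝ, 0 < c → ℓ (z.1, c • z.2) = c ^ 2 * ℓ z)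

lemma hasFDerivAt_zero_snd (z : E × E) : HasFDerivAt (fun y : E × E => ((0 : E), y.2))
    ((0 : E × E →L[ℝ] E).prod (ContinuousLinearMap.snd ℝ E E)) z :=
  ((0 : E × E →L[ℝ] E).prod (ContinuousLinearMap.snd ℝ E E)).hasFDerivAt

include hO hℓ hom in
-- Differentiate Euler's relation ∂_vℓ(v) = 2ℓ in the direction `a`; the last term comes from the
-- dependence of the argument v on the point.
lemma fderiv_fderiv_fiber_self (hz : z ∈ O) (a : E × E) :
    fderiv ℝ (fderiv ℝ ℓ) z a (0, z.2) = 2 * fderiv ℝ ℓ z a - fderiv ℝ ℓ z (0, a.2) := by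
  have hc : ∀ y ∈ O, ContDiffAt ℝ ∞ ℓ y := fun y hy => hℓ.contDiffAt (hO.mem_nhds hy)
  have hd : DifferentiableAt ℝ (fderiv ℝ ℓ) z :=
    (contDiffAt_fderiv (hc z hz)).differentiableAt (by simp)
  have ev : (fun y => fderiv ℝ ℓ y (0, y.2)) =ᶠ[𝓝 z] fun y => 2 * ℓ y := by
    filter_upwards [hO.mem_nhds hz] with y hy using
      fderiv_fiber_self ((hc y hy).differentiableAt (by simp)) (hom y hy)
  have e1 := ev.fderiv_eq (𝕜 := ℝ)
  rw [(hd.hasFDerivAt.clm_apply (hasFDerivAt_zero_snd z)).fderiv,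
    (((hc z hz).differentiableAt (by simp)).hasFDerivAt.const_mul 2).fderiv] at e1
  have := DFunLike.congr_fun e1 a
  simp at this
  linarith

include hO hℓ hom in
-- For vertical directions the two first-order terms merge: this is g_v(v, w) = ½ ∂_vℓ(w), up to the
-- factor ½ in the fundamental tensor.
lemma fderiv_fderiv_fiber_self' (hz : z ∈ O) (w : E) :
    fderiv ℝ (fderiv ℝ ℓ) z (0, w) (0, z.2) = fderiv ℝ ℓ z (0, w) := by
  rw [fderiv_fderiv_fiber_self hO hℓ hom hz]; simp; ring

include hO hℓ hom in
/-- Differentiating `∂²ℓ(v, w) = ∂ℓ(w)`. -/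
lemma fderiv_fderiv_fderiv_fiber_self (hz : z ∈ O) (a : E × E) (w : E) :
    fderiv ℝ (fderiv ℝ (fderiv ℝ ℓ)) z a (0, w) (0, z.2) =
      fderiv ℝ (fderiv ℝ ℓ) z a (0, w) - fderiv ℝ (fderiv ℝ ℓ) z (0, a.2) (0, w) := by
  have hc : ∀ y ∈ O, ContDiffAt ℝ ∞ ℓ y := fun y hy => hℓ.contDiffAt (hO.mem_nhds hy)
  have hd : DifferentiableAt ℝ (fderiv ℝ ℓ) z :=
    (contDiffAt_fderiv (hc z hz)).differentiableAt (by simp)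
  have hd2 : DifferentiableAt ℝ (fderiv ℝ (fderiv ℝ ℓ)) z :=
    (contDiffAt_fderiv (contDiffAt_fderiv (hc z hz))).differentiableAt (by simp)
  have ev : (fun y => fderiv ℝ (fderiv ℝ ℓ) y (0, w) (0, y.2)) =ᶠ[𝓝 z]
      fun y => fderiv ℝ ℓ y (0, w) := by
    filter_upwards [hO.mem_nhds hz] with y hy using fderiv_fderiv_fiber_self' hO hℓ hom hy w
  have e1 := ev.fderiv_eq (𝕜 := ℝ)
  rw [((hd2.hasFDerivAt.clm_apply (hasFDerivAt_const ((0 : E), w) z)).clm_apply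
      (hasFDerivAt_zero_snd z)).fderiv,
    (hd.hasFDerivAt.clm_apply (hasFDerivAt_const ((0 : E), w) z)).fderiv] at e1
  have := DFunLike.congr_fun e1 a
  simp at this
  rw [fderiv_fderiv_symm (hc z hz) (0, w) (0, a.2)] at this
  linarith

end Homogeneous

/-! ### Linear algebra of the Koszul formula with a Cartan term -/

section Koszul

variable {E : Type*} [NormedAddCommGroup E] [NormedSpace ℝ E] [FiniteDimensional ℝ E]

/-- An injective linear map from `E` to its dual is onto by dimension, so an indefinite `g`
represents functionals as well as an inner product does. -/
lemma exists_forall_eq_of_nondegenerate (g : E →L[ℝ] E →L[ℝ] ℝ)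
    (hg : ∀ u, (∀ w, g u w = 0) → u = 0) (f : E → ℝ) (hf : IsLinearMap ℝ f) :
    ∃ u, ∀ w, g u w = f w := by
  let B : E →ₗ[ℝ] Module.Dual ℝ E :=
    { toFun := fun u => (g u : E →ₗ[ℝ] ℝ)
      map_add' := fun _ _ => by ext; simp
      map_smul' := fun _ _ => by ext; simp }
  have hB : Function.Injective B := by
    rw [injective_iff_map_eq_zero]
    intro u hu
    exact hg u fun w => by simpa [B] using DFunLike.congr_fun hu w
  have hS : Function.Surjective B :=
    (LinearMap.injective_iff_surjective_of_finrank_eq_finrank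
      (Subspace.dual_finrank_eq (K := ℝ) (V := E)).symm).1 hB
  obtain ⟨u, hu⟩ := hS (hf.mk' f)
  exact ⟨u, fun w => by simpa [B] using DFunLike.congr_fun hu w⟩

/-- The algebraic Koszul formula for the Chern connection: `dg x y z` is the derivative of
`g(y, z)` in the direction `x`, and `C` is the Cartan tensor. -/
lemma exists_chern_christoffel (g : E →L[ℝ] E →L[ℝ] ℝ) (dg C : E → E → E → ℝ) (v : E)
    (hg : ∀ u, (∀ w, g u w = 0) → u = 0) (gs : ∀ x y, g x y = g y x)
    (dg₁ : ∀ y z, IsLinearMap ℝ fun x => dg x y z) (dg₃ : ∀ x y, IsLinearMap ℝ fun z => dg x y z)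
    (C₃ : ∀ x y, IsLinearMap ℝ fun z => C x y z)
    (dgs : ∀ x y z, dg x y z = dg x z y) (C₁₂ : ∀ x y z, C x y z = C y x z)
    (C₂₃ : ∀ x y z, C x y z = C x z y) (Cv : ∀ x y, C x y v = 0) :
    ∃ Γ : E →L[ℝ] E →L[ℝ] E, (∀ x y, Γ x y = Γ y x) ∧
      ∀ x y z, dg x y z = g (Γ x y) z + g y (Γ x z) + 2 * C (Γ x v) y z := by
  have inj : ∀ u u', (∀ w, g u w = g u' w) → u = u' := fun u u' h => by
    rw [← sub_eq_zero]; exact hg _ fun w => by simp [h]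
  have a₁ : ∀ a b y z, dg (a + b) y z = dg a y z + dg b y z := fun a b y z => (dg₁ y z).map_add a b
  have m₁ : ∀ (c : ℝ) b y z, dg (c • b) y z = c * dg b y z := fun a b y z => (dg₁ y z).map_smul a b
  have a₃ : ∀ a b y z, dg y z (a + b) = dg y z a + dg y z b := fun a b y z => (dg₃ y z).map_add a b
  have m₃ : ∀ (c : ℝ) b y z, dg y z (c • b) = c * dg y z b := fun a b y z => (dg₃ y z).map_smul a b
  have a₂ : ∀ a b y z, dg y (a + b) z = dg y a z + dg y b z := fun a b y z => by
    rw [dgs, a₃, dgs _ a, dgs _ b]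
  have m₂ : ∀ (c : ℝ) b y z, dg y (c • b) z = c * dg y b z := fun a b y z => by
    rw [dgs, m₃, dgs _ b]
  have p₃ : ∀ a b y z, C y z (a + b) = C y z a + C y z b := fun a b y z => (C₃ y z).map_add a b
  have q₃ : ∀ (c : ℝ) b y z, C y z (c • b) = c * C y z b := fun a b y z => (C₃ y z).map_smul a b
  have p₂ : ∀ a b y z, C y (a + b) z = C y a z + C y b z := fun a b y z => by
    rw [C₂₃, p₃, C₂₃ _ a, C₂₃ _ b]
  have q₂ : ∀ (c : ℝ) b y z, C y (c • b) z = c * C y b z := fun a b y z => by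
    rw [C₂₃, q₃, C₂₃ _ b]
  have p₁ : ∀ a b y z, C (a + b) y z = C a y z + C b y z := fun a b y z => by
    rw [C₁₂, p₂, C₁₂ a, C₁₂ b]
  have q₁ : ∀ (c : ℝ) b y z, C (c • b) y z = c * C b y z := fun a b y z => by
    rw [C₁₂, q₂, C₁₂ b]
  have Cv2 : ∀ x y, C x v y = 0 := fun x y => by rw [C₂₃, Cv]
  -- The system is triangular because `C` vanishes as soon as one slot is `v`. First comes `G`, the
  -- value forced on Γ(v, v), whose equation has no Cartan term.
  obtain ⟨G, hG⟩ := exists_forall_eq_of_nondegenerate g hg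
    (fun z => dg v v z - (1 / 2) * dg z v v)
    ⟨fun a b => by simp only [a₁, a₃]; ring, fun a b => by simp only [m₁, m₃, smul_eq_mul]; ring⟩
  -- Next the value `N y` forced on Γ(y, v): the only surviving Cartan term contains `G`.
  have hN : ∀ y, ∃ u, ∀ z, g u z = (1 / 2) * (dg v y z + dg y v z - dg z v y) - C G y z :=
    fun y => exists_forall_eq_of_nondegenerate g hg _
      ⟨fun a b => by simp only [a₁, a₃, p₃]; ring,
        fun a b => by simp only [m₁, m₃, q₃, smul_eq_mul]; ring⟩
  choose N hN using hN
  have Nadd : ∀ a b, N (a + b) = N a + N b := fun a b => inj _ _ fun w => by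
    simp only [hN, map_add, add_apply, a₁, a₂, a₃, p₂]; ring
  have Nsmul : ∀ (c : ℝ) b, N (c • b) = c • N b := fun a b => inj _ _ fun w => by
    simp only [hN, map_smul, smul_apply, smul_eq_mul, m₁, m₂, m₃, q₂]; ring
  have Nv : N v = G := inj _ _ fun w => by
    rw [hN, hG, Cv2]; ring
  -- Finally the full Koszul formula, in which Γ(·, v) has been replaced by the known `N`.
  have hΓ : ∀ x y, ∃ u, ∀ z, g u z = (1 / 2) * (dg x y z + dg y x z - dg z x y)
      - C (N x) y z - C (N y) x z + C (N z) x y :=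
    fun x y => exists_forall_eq_of_nondegenerate g hg _
      ⟨fun a b => by simp only [Nadd, a₁, a₃, p₁, p₃]; ring,
        fun a b => by simp only [Nsmul, m₁, m₃, q₁, q₃, smul_eq_mul]; ring⟩
  choose Γ hΓ using hΓ
  have Γs : ∀ x y, Γ x y = Γ y x := fun x y => inj _ _ fun w => by
    rw [hΓ, hΓ, dgs w, C₂₃ _ x y]; ring
  -- Consistency: the solution does have Γ(·, v) = `N`, so the replacement was legitimate.
  have ΓN : ∀ x, Γ x v = N x := fun x => inj _ _ fun w => by
    rw [hΓ, hN, Cv2, Cv, Nv, dgs w]; ring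
  have Γadd : ∀ a b c, Γ (a + b) c = Γ a c + Γ b c := fun a b c => inj _ _ fun w => by
    simp only [hΓ, Nadd, map_add, add_apply, a₁, a₂, p₁, p₂]; ring
  have Γsmul : ∀ (r : ℝ) b c, Γ (r • b) c = r • Γ b c := fun a b c => inj _ _ fun w => by
    simp only [hΓ, Nsmul, map_smul, smul_apply, smul_eq_mul, m₁, m₂, q₁, q₂]
    ring
  let Γ' : E →ₗ[ℝ] E →ₗ[ℝ] E := LinearMap.mk₂ ℝ Γ Γadd Γsmul
    (fun a b c => by rw [Γs, Γadd, Γs b, Γs c]) (fun r a b => by rw [Γs, Γsmul, Γs b])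
  let Γ'' : E →L[ℝ] E →L[ℝ] E :=
    LinearMap.toContinuousLinearMap
      ((LinearMap.toContinuousLinearMap : (E →ₗ[ℝ] E) ≃ₗ[ℝ] _).toLinearMap ∘ₗ Γ')
  have e : ∀ x y, Γ'' x y = Γ x y := fun x y => rfl
  refine ⟨Γ'', fun x y => by simp only [e, Γs], fun x y z => ?_⟩
  simp only [e]
  rw [gs y, hΓ, hΓ, ΓN, dgs x z y, C₂₃ (N x) z y]
  ring

end Koszul

end PseudoFinsler

/-! ### The metric and its tensors in a chart of the tangent bundle -/

namespace PseudoFinsler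

variable {E : Type*} [NormedAddCommGroup E] [NormedSpace ℝ E] [FiniteDimensional ℝ E]
  {M : Type*} [TopologicalSpace M] [ChartedSpace E M] [IsManifold 𝓘(ℝ, E) ∞ M]

/-- The inverse of the chart of the tangent bundle induced by the preferred chart at `p`. -/
def tangentChartSymm (p : M) (z : E × E) : TangentBundle 𝓘(ℝ, E) M :=
  ⟨(extChartAt 𝓘(ℝ, E) p).symm z.1,
    (trivializationAt E (TangentSpace 𝓘(ℝ, E) : M → Type _) p).symm
      ((extChartAt 𝓘(ℝ, E) p).symm z.1) z.2⟩

/-- The components of tangent vectors at `q` in the preferred chart at `p`. -/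
def vecCoord (p q : M) : TangentSpace 𝓘(ℝ, E) q →L[ℝ] E :=
  (trivializationAt E (TangentSpace 𝓘(ℝ, E) : M → Type _) p).continuousLinearMapAt ℝ q

/-- The tangent vector at `q` with the given components in the preferred chart at `p`. -/
def vecOfCoord (p q : M) : E →L[ℝ] TangentSpace 𝓘(ℝ, E) q :=
  (trivializationAt E (TangentSpace 𝓘(ℝ, E) : M → Type _) p).symmL ℝ q

/-- The metric in the preferred chart at `p`. -/
def chartLagrangian (F : PseudoFinslerMetric E M) (p : M) (z : E × E) : ℝ :=
  F.L (tangentChartSymm p z)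

/-- The domain of the metric in the preferred chart at `p`. -/
def chartDomain (F : PseudoFinslerMetric E M) (p : M) : Set (E × E) :=
  {z | z.1 ∈ (extChartAt 𝓘(ℝ, E) p).target ∧ tangentChartSymm p z ∈ F.A}

section Coord

variable {p q : M} (hq : q ∈ (chartAt E p).source)
include hq

lemma vecCoord_apply (v : TangentSpace 𝓘(ℝ, E) q) :
    vecCoord p q v = (trivializationAt E (TangentSpace 𝓘(ℝ, E) : M → Type _) p
      (⟨q, v⟩ : TangentBundle 𝓘(ℝ, E) M)).2 := by
  rw [vecCoord, Bundle.Trivialization.continuousLinearMapAt_apply,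
    Bundle.Trivialization.linearMapAt_apply, if_pos (by simpa using hq)]

lemma vecCoord_eq_mfderiv :
    vecCoord p q = mfderiv 𝓘(ℝ, E) 𝓘(ℝ, E) (extChartAt 𝓘(ℝ, E) p) q :=
  TangentBundle.continuousLinearMapAt_trivializationAt hq

lemma vecOfCoord_vecCoord (v : TangentSpace 𝓘(ℝ, E) q) : vecOfCoord p q (vecCoord p q v) = v :=
  Bundle.Trivialization.symmL_continuousLinearMapAt _ (by simpa using hq) v

lemma vecCoord_vecOfCoord (v : E) : vecCoord p q (vecOfCoord p q v) = v :=
  Bundle.Trivialization.continuousLinearMapAt_symmL _ (by simpa using hq) v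

lemma tangentChartSymm_vecCoord (v : TangentSpace 𝓘(ℝ, E) q) :
    tangentChartSymm p (extChartAt 𝓘(ℝ, E) p q, vecCoord p q v) =
      (⟨q, v⟩ : TangentBundle 𝓘(ℝ, E) M) := by
  have h1 : (extChartAt 𝓘(ℝ, E) p).symm (extChartAt 𝓘(ℝ, E) p q) = q :=
    (extChartAt 𝓘(ℝ, E) p).left_inv (by simpa using hq)
  have h2 := vecOfCoord_vecCoord hq v
  rw [vecOfCoord, Bundle.Trivialization.symmL_apply _ (by simpa using hq)] at h2
  simp only [tangentChartSymm]
  rw [h1, h2]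

lemma mem_chartDomain_iff (F : PseudoFinslerMetric E M) (v : TangentSpace 𝓘(ℝ, E) q) :
    (extChartAt 𝓘(ℝ, E) p q, vecCoord p q v) ∈ chartDomain F p ↔
      (⟨q, v⟩ : TangentBundle 𝓘(ℝ, E) M) ∈ F.A := by
  rw [chartDomain, mem_ofPred_eq, tangentChartSymm_vecCoord hq]
  exact and_iff_right ((extChartAt 𝓘(ℝ, E) p).map_source (by simpa using hq))

lemma chartLagrangian_vecCoord (F : PseudoFinslerMetric E M) (v : TangentSpace 𝓘(ℝ, E) q) :
    chartLagrangian F p (extChartAt 𝓘(ℝ, E) p q, vecCoord p q v) = F.L ⟨q, v⟩ := by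
  rw [chartLagrangian, tangentChartSymm_vecCoord hq]

end Coord

lemma contMDiffOn_tangentChartSymm (p : M) :
    ContMDiffOn 𝓘(ℝ, E × E) 𝓘(ℝ, E).tangent ∞ (tangentChartSymm (E := E) p)
      ((extChartAt 𝓘(ℝ, E) p).target ×ˢ univ) := by
  have h1 := (trivializationAt E (TangentSpace 𝓘(ℝ, E) : M → Type _) p).contMDiffOn_symm
    (IB := 𝓘(ℝ, E)) (n := ∞)
  have h2 : ContMDiffOn 𝓘(ℝ, E × E) 𝓘(ℝ, E) ∞
      (fun z : E × E => (extChartAt 𝓘(ℝ, E) p).symm z.1)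
      ((extChartAt 𝓘(ℝ, E) p).target ×ˢ univ) :=
    (contMDiffOn_extChartAt_symm p).comp contDiff_fst.contMDiff.contMDiffOn
      (fun z hz => hz.1)
  have h3 := h2.prodMk (contDiff_snd (𝕜 := ℝ) (E := E) (F := E) (n := ∞)).contMDiff.contMDiffOn
  have hmem : ∀ z ∈ (extChartAt 𝓘(ℝ, E) p).target ×ˢ (univ : Set E),
      (extChartAt 𝓘(ℝ, E) p).symm z.1 ∈ (chartAt E p).source := fun z hz => by
    simpa using (extChartAt 𝓘(ℝ, E) p).map_target hz.1
  refine (h1.comp h3 fun z hz => ?_).congr fun z hz => ?_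
  · simpa using hmem z hz
  · exact (Bundle.Trivialization.mk_symm _ (by simpa using hmem z hz) _)

lemma isOpen_chartDomain (F : PseudoFinslerMetric E M) (p : M) : IsOpen (chartDomain F p) := by
  have := (contMDiffOn_tangentChartSymm p).continuousOn.isOpen_inter_preimage
    ((isOpen_extChartAt_target (I := 𝓘(ℝ, E)) p).prod isOpen_univ) F.isOpen_A
  convert this using 1
  ext z
  simp [chartDomain]

lemma contDiffOn_chartLagrangian (F : PseudoFinslerMetric E M) (p : M) :
    ContDiffOn ℝ ∞ (chartLagrangian F p) (chartDomain F p) := by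
  rw [← contMDiffOn_iff_contDiffOn]
  exact F.contMDiffOn_L.comp ((contMDiffOn_tangentChartSymm p).mono fun z hz => ⟨hz.1, trivial⟩)
    fun z hz => hz.2

lemma chartLagrangian_smul (F : PseudoFinslerMetric E M) (p : M) :
    ∀ z ∈ chartDomain F p, ∀ c : ℝ, 0 < c →
      chartLagrangian F p (z.1, c • z.2) = c ^ 2 * chartLagrangian F p z := by
  intro z hz c hc
  have := F.homogeneous _ _ c hc hz.2
  simp only [chartLagrangian, tangentChartSymm]
  rw [← this]
  have hm : (extChartAt 𝓘(ℝ, E) p).symm z.1 ∈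
      (trivializationAt E (TangentSpace 𝓘(ℝ, E) : M → Type _) p).baseSet := by
    simpa using (extChartAt 𝓘(ℝ, E) p).map_target hz.1
  rw [← Bundle.Trivialization.symmL_apply (R := ℝ) _ hm,
    ← Bundle.Trivialization.symmL_apply (R := ℝ) _ hm, map_smul]

section Tensors

variable {F : PseudoFinslerMetric E M} {p q : M} (hq : q ∈ (chartAt E p).source)
  {v : TangentSpace 𝓘(ℝ, E) q} (hv : (⟨q, v⟩ : TangentBundle 𝓘(ℝ, E) M) ∈ F.A)
include hq hv

/-- The chart is linear on fibres, so lines in a fibre become vertical lines. The chart is centred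
at any `p` whose domain contains `q`, which allows `q` to vary in a fixed chart. -/
lemma fundamentalTensor_eq (u w : TangentSpace 𝓘(ℝ, E) q) :
    fundamentalTensor F.L v u w = (1 / 2) *
      fderiv ℝ (fderiv ℝ (chartLagrangian F p)) (extChartAt 𝓘(ℝ, E) p q, vecCoord p q v)
        (0, vecCoord p q u) (0, vecCoord p q w) := by
  rw [← deriv_deriv_line (isOpen_chartDomain F p) (contDiffOn_chartLagrangian F p)
    ((mem_chartDomain_iff hq F v).2 hv), fundamentalTensor]
  congr! 5 with t s
  rw [← chartLagrangian_vecCoord hq]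
  simp

lemma cartanTensor_eq (w₁ w₂ w₃ : TangentSpace 𝓘(ℝ, E) q) :
    cartanTensor F.L v w₁ w₂ w₃ = (1 / 4) *
      fderiv ℝ (fderiv ℝ (fderiv ℝ (chartLagrangian F p)))
        (extChartAt 𝓘(ℝ, E) p q, vecCoord p q v)
        (0, vecCoord p q w₁) (0, vecCoord p q w₂) (0, vecCoord p q w₃) := by
  rw [← deriv_deriv_deriv_line (isOpen_chartDomain F p) (contDiffOn_chartLagrangian F p)
    ((mem_chartDomain_iff hq F v).2 hv), cartanTensor]
  congr! 7 with t s
  rw [← chartLagrangian_vecCoord hq]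
  simp

end Tensors

section Scalar

variable {p q : M} (hq : q ∈ (chartAt E p).source) {G : Type*} [NormedAddCommGroup G]
  [NormedSpace ℝ G] {f : M → G}
include hq

lemma differentiableAt_comp_extChartAt_symm (hf : MDifferentiableAt 𝓘(ℝ, E) 𝓘(ℝ, G) f q) :
    DifferentiableAt ℝ (f ∘ (extChartAt 𝓘(ℝ, E) p).symm) (extChartAt 𝓘(ℝ, E) p q) := by
  have hqs : q ∈ (extChartAt 𝓘(ℝ, E) p).source := by simpa using hq
  have hinv := (extChartAt 𝓘(ℝ, E) p).left_inv hqs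
  have hms : MDifferentiableAt 𝓘(ℝ, E) 𝓘(ℝ, E) (extChartAt 𝓘(ℝ, E) p).symm
      (extChartAt 𝓘(ℝ, E) p q) :=
    ((contMDiffOn_extChartAt_symm (n := ∞) p).contMDiffAt ((isOpen_extChartAt_target p).mem_nhds
      ((extChartAt 𝓘(ℝ, E) p).map_source hqs))).mdifferentiableAt (by simp)
  exact (MDifferentiableAt.comp _ (by rwa [hinv]) hms).differentiableAt

/-- A scalar or vector valued function on the manifold can be differentiated in a chart. -/
lemma mvfderiv_eq_fderiv_comp_symm
    (hf : DifferentiableAt ℝ (f ∘ (extChartAt 𝓘(ℝ, E) p).symm) (extChartAt 𝓘(ℝ, E) p q))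
    (u : TangentSpace 𝓘(ℝ, E) q) :
    mvfderiv 𝓘(ℝ, E) f q u =
      fderiv ℝ (f ∘ (extChartAt 𝓘(ℝ, E) p).symm) (extChartAt 𝓘(ℝ, E) p q) (vecCoord p q u) := by
  set φ := extChartAt 𝓘(ℝ, E) p with hφ
  have hqs : q ∈ φ.source := by simpa [hφ] using hq
  have hc : mfderiv 𝓘(ℝ, E) 𝓘(ℝ, G) ((f ∘ φ.symm) ∘ φ) q =
      (mfderiv 𝓘(ℝ, E) 𝓘(ℝ, G) (f ∘ φ.symm) (φ q)).comp (mfderiv 𝓘(ℝ, E) 𝓘(ℝ, E) φ q) :=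
    mfderiv_comp q hf.mdifferentiableAt (mdifferentiableAt_extChartAt hq)
  have hcongr : mfderiv 𝓘(ℝ, E) 𝓘(ℝ, G) ((f ∘ φ.symm) ∘ φ) q = mfderiv 𝓘(ℝ, E) 𝓘(ℝ, G) f q := by
    apply Filter.EventuallyEq.mfderiv_eq
    filter_upwards [(isOpen_extChartAt_source (I := 𝓘(ℝ, E)) p).mem_nhds hqs] with y hy
    simp only [Function.comp_apply]
    rw [φ.left_inv hy]
  change mfderiv 𝓘(ℝ, E) 𝓘(ℝ, G) f q u = _
  rw [← hcongr, hc, mfderiv_eq_fderiv, vecCoord_eq_mfderiv hq]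
  rfl

end Scalar

/-! ### Vector fields and Lie brackets in components -/

section Fields

/-- The components of a vector field in the preferred chart at `p`. -/
def fieldCoord (p : M) (X : Π q : M, TangentSpace 𝓘(ℝ, E) q) (q : M) : E := vecCoord p q (X q)

/-- The derivative of the components of a vector field in the preferred chart at `p`. -/
def fieldDeriv (p : M) (X : Π q : M, TangentSpace 𝓘(ℝ, E) q) (q : M) :
    TangentSpace 𝓘(ℝ, E) q →L[ℝ] E :=
  mvfderiv 𝓘(ℝ, E) (fieldCoord p X) q

variable {p q : M} (hq : q ∈ (chartAt E p).source)

include hq in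
lemma mdifferentiableAt_fieldCoord {X : Π q : M, TangentSpace 𝓘(ℝ, E) q}
    (hX : MDifferentiableAt 𝓘(ℝ, E) 𝓘(ℝ, E).tangent
      (fun q => (⟨q, X q⟩ : TangentBundle 𝓘(ℝ, E) M)) q) :
    MDifferentiableAt 𝓘(ℝ, E) 𝓘(ℝ, E) (fieldCoord p X) q := by
  have := ((trivializationAt E (TangentSpace 𝓘(ℝ, E) : M → Type _) p).mdifferentiableAt_section_iff
    𝓘(ℝ, E) X (by simpa using hq)).1 hX
  refine this.congr_of_eventuallyEq ?_
  filter_upwards [(chartAt E p).open_source.mem_nhds hq] with y hy using vecCoord_apply hy _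

include hq in
lemma fieldCoord_extend (w : TangentSpace 𝓘(ℝ, E) p) :
    fieldCoord p (FiberBundle.extend E w) q = vecCoord p p w := by
  rw [vecCoord_apply (mem_chart_source E p), fieldCoord, FiberBundle.extend,
    ← Bundle.Trivialization.symmL_apply (R := ℝ) _ (by simpa using hq)]
  exact vecCoord_vecOfCoord hq _

lemma fieldCoord_extend_eventuallyEq (hq : q ∈ (chartAt E p).source)
    (w : TangentSpace 𝓘(ℝ, E) p) :
    fieldCoord p (FiberBundle.extend E w) =ᶠ[𝓝 q] fun _ => vecCoord p p w := by
  filter_upwards [(chartAt E p).open_source.mem_nhds hq] with y hy using fieldCoord_extend hy w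

lemma isSmoothFieldOn_extend (w : TangentSpace 𝓘(ℝ, E) p) :
    IsSmoothFieldOn (FiberBundle.extend E w) (chartAt E p).source := by
  intro q hq
  have := ((trivializationAt E (TangentSpace 𝓘(ℝ, E) : M → Type _) p).contMDiffAt_section_iff
    (s := FiberBundle.extend E w) (n := ∞)
    (IB := 𝓘(ℝ, E)) (by simpa using hq)).2
    ((contMDiffAt_const (c := vecCoord p p w)).congr_of_eventuallyEq (by
      filter_upwards [(chartAt E p).open_source.mem_nhds hq] with y hy
      rw [← vecCoord_apply hy]
      exact fieldCoord_extend hy w))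
  exact this.contMDiffWithinAt

lemma mlieBracket_vectorSpace (X Y : Π x : E, TangentSpace 𝓘(ℝ, E) x) (x : E) :
    VectorField.mlieBracket 𝓘(ℝ, E) X Y x =
      fderiv ℝ (Y : E → E) x (X x) - fderiv ℝ (X : E → E) x (Y x) := by
  rw [← VectorField.mlieBracketWithin_univ, VectorField.mlieBracketWithin_eq_lieBracketWithin]
  exact congrFun (VectorField.lieBracketWithin_univ
    (𝕜 := ℝ) (V := (X : E → E)) (W := (Y : E → E))) x

include hq in
-- The bracket commutes with pullback under the inverse chart. That pullback turns a field into its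
-- components, and in a vector space the bracket is the difference of directional derivatives.
lemma vecCoord_mlieBracket {X Y : Π q : M, TangentSpace 𝓘(ℝ, E) q}
    (hX : MDifferentiableAt 𝓘(ℝ, E) 𝓘(ℝ, E).tangent
      (fun q => (⟨q, X q⟩ : TangentBundle 𝓘(ℝ, E) M)) q)
    (hY : MDifferentiableAt 𝓘(ℝ, E) 𝓘(ℝ, E).tangent
      (fun q => (⟨q, Y q⟩ : TangentBundle 𝓘(ℝ, E) M)) q) :
    vecCoord p q (VectorField.mlieBracket 𝓘(ℝ, E) X Y q) =
      fieldDeriv p Y q (X q) - fieldDeriv p X q (Y q) := by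
  set φ := extChartAt 𝓘(ℝ, E) p with hφ
  have hqs : q ∈ φ.source := by simpa [hφ] using hq
  have hx : φ q ∈ φ.target := φ.map_source hqs
  have hinv : φ.symm (φ q) = q := φ.left_inv hqs
  have hinvd : ∀ y ∈ φ.target,
      (mfderiv 𝓘(ℝ, E) 𝓘(ℝ, E) φ.symm y).inverse = vecCoord p (φ.symm y) := by
    intro y hy
    have hs : φ.symm y ∈ (chartAt E p).source := by simpa [hφ] using φ.map_target hy
    rw [vecCoord_eq_mfderiv hs]
    have e1 := mfderiv_extChartAt_comp_mfderivWithin_extChartAt_symm (I := 𝓘(ℝ, E)) hy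
    have e2 := mfderivWithin_extChartAt_symm_comp_mfderiv_extChartAt (I := 𝓘(ℝ, E)) hy
    simp only [modelWithCornersSelf_coe, range_id, mfderivWithin_univ] at e1 e2
    exact ContinuousLinearMap.inverse_eq e2 e1
  have pull : ∀ Z : Π q : M, TangentSpace 𝓘(ℝ, E) q, ∀ y ∈ φ.target,
      VectorField.mpullback 𝓘(ℝ, E) 𝓘(ℝ, E) φ.symm Z y = fieldCoord p Z (φ.symm y) := by
    intro Z y hy
    rw [VectorField.mpullback_apply, hinvd y hy]
    rfl
  have hopen : φ.target ∈ 𝓝 (φ q) := (isOpen_extChartAt_target p).mem_nhds hx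
  have hd : ∀ Z : Π q : M, TangentSpace 𝓘(ℝ, E) q, MDifferentiableAt 𝓘(ℝ, E) 𝓘(ℝ, E).tangent
      (fun q => (⟨q, Z q⟩ : TangentBundle 𝓘(ℝ, E) M)) q → ∀ u : TangentSpace 𝓘(ℝ, E) q,
      fderiv ℝ (fun y => fieldCoord p Z (φ.symm y)) (φ q) (vecCoord p q u) = fieldDeriv p Z q u :=
    fun Z hZ u =>
      (mvfderiv_eq_fderiv_comp_symm hq
        (differentiableAt_comp_extChartAt_symm hq (mdifferentiableAt_fieldCoord hq hZ)) u).symm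
  have : IsManifold 𝓘(ℝ, E) (minSmoothness ℝ 2) M := by
    rw [minSmoothness_of_isRCLikeNormedField]; infer_instance
  have : IsManifold 𝓘(ℝ, E) (minSmoothness ℝ 2) E := by
    rw [minSmoothness_of_isRCLikeNormedField]; infer_instance
  have main := VectorField.mpullback_mlieBracket (I := 𝓘(ℝ, E)) (I' := 𝓘(ℝ, E))
    (n := ∞) (f := φ.symm) (x₀ := φ q) (V := X) (W := Y) (by rwa [hinv]) (by rwa [hinv])
    ((contMDiffOn_extChartAt_symm (n := ∞) p).contMDiffAt hopen)
    (by simpa using WithTop.coe_le_coe.2 (le_top : (2 : ℕ∞) ≤ ⊤))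
  rw [pull _ _ hx] at main
  replace main := main.trans (mlieBracket_vectorSpace _ _ _)
  have hXe : VectorField.mpullback 𝓘(ℝ, E) 𝓘(ℝ, E) φ.symm X =ᶠ[𝓝 (φ q)]
      fun y => fieldCoord p X (φ.symm y) := by filter_upwards [hopen] with y hy using pull X y hy
  have hYe : VectorField.mpullback 𝓘(ℝ, E) 𝓘(ℝ, E) φ.symm Y =ᶠ[𝓝 (φ q)]
      fun y => fieldCoord p Y (φ.symm y) := by filter_upwards [hopen] with y hy using pull Y y hy
  rw [hXe.fderiv_eq, hYe.fderiv_eq, hXe.eq_of_nhds, hYe.eq_of_nhds] at main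
  simp only [fieldCoord] at main
  rw [hinv] at main
  rw [main, ← hd X hX, ← hd Y hY]
  rfl

end Fields

end PseudoFinsler

/-! ### Existence of the Chern connection and its Koszul formula -/

namespace PseudoFinsler

variable {E : Type*} [NormedAddCommGroup E] [NormedSpace ℝ E] [FiniteDimensional ℝ E]
  {M : Type*} [TopologicalSpace M] [ChartedSpace E M] [IsManifold 𝓘(ℝ, E) ∞ M]

set_option synthInstance.maxHeartbeats 200000 in
lemma fderiv_clm_apply₂ {G E' : Type*} [NormedAddCommGroup G] [NormedSpace ℝ G]
    [NormedAddCommGroup E'] [NormedSpace ℝ E'] {f : G → G →L[ℝ] G →L[ℝ] ℝ} {c a b : E' → G} {x : E'}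
    (hf : DifferentiableAt ℝ f (c x)) (hc : DifferentiableAt ℝ c x) (ha : DifferentiableAt ℝ a x)
    (hb : DifferentiableAt ℝ b x) :
    DifferentiableAt ℝ (fun y => f (c y) (a y) (b y)) x ∧
      ∀ u, fderiv ℝ (fun y => f (c y) (a y) (b y)) x u =
        fderiv ℝ f (c x) (fderiv ℝ c x u) (a x) (b x) + f (c x) (fderiv ℝ a x u) (b x) +
          f (c x) (a x) (fderiv ℝ b x u) := by
  have h₁ : HasFDerivAt (fun y => f (c y)) ((fderiv ℝ f (c x)).comp (fderiv ℝ c x)) x :=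
    HasFDerivAt.comp x (g := f) (f := c) hf.hasFDerivAt hc.hasFDerivAt
  have h := (h₁.clm_apply ha.hasFDerivAt).clm_apply hb.hasFDerivAt
  refine ⟨h.differentiableAt, fun u => ?_⟩
  erw [h.fderiv]
  simp
  ring

section FieldsInChart

variable {F : PseudoFinslerMetric E M} {p q : M}
  {V Y Z : Π q : M, TangentSpace 𝓘(ℝ, E) q} {v : E}

/-- The derivative of `g_V(Y, Z)`, where `V` has constant components in a chart. -/
lemma mvfderiv_fundamentalTensor (hq : q ∈ (chartAt E p).source)
    (hVc : fieldCoord p V =ᶠ[𝓝 q] fun _ => v)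
    (hVA : ∀ᶠ q' in 𝓝 q, (⟨q', V q'⟩ : TangentBundle 𝓘(ℝ, E) M) ∈ F.A)
    (hY : MDifferentiableAt 𝓘(ℝ, E) 𝓘(ℝ, E).tangent
      (fun q => (⟨q, Y q⟩ : TangentBundle 𝓘(ℝ, E) M)) q)
    (hZ : MDifferentiableAt 𝓘(ℝ, E) 𝓘(ℝ, E).tangent
      (fun q => (⟨q, Z q⟩ : TangentBundle 𝓘(ℝ, E) M)) q) (u : TangentSpace 𝓘(ℝ, E) q) :
    mvfderiv 𝓘(ℝ, E) (fun q => fundamentalTensor F.L (V q) (Y q) (Z q)) q u = (1 / 2) *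
      (fderiv ℝ (fderiv ℝ (fderiv ℝ (chartLagrangian F p))) (extChartAt 𝓘(ℝ, E) p q, v)
          (vecCoord p q u, 0) (0, fieldCoord p Y q) (0, fieldCoord p Z q) +
        fderiv ℝ (fderiv ℝ (chartLagrangian F p)) (extChartAt 𝓘(ℝ, E) p q, v)
          (0, fieldDeriv p Y q u) (0, fieldCoord p Z q) +
        fderiv ℝ (fderiv ℝ (chartLagrangian F p)) (extChartAt 𝓘(ℝ, E) p q, v)
          (0, fieldCoord p Y q) (0, fieldDeriv p Z q u)) := by
  set φ := extChartAt 𝓘(ℝ, E) p with hφ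
  set ℓ := chartLagrangian F p
  have hqs : q ∈ φ.source := by simpa [hφ] using hq
  have hinv : φ.symm (φ q) = q := φ.left_inv hqs
  have hmem : (φ q, v) ∈ chartDomain F p := by
    rw [← hVc.eq_of_nhds]; exact (mem_chartDomain_iff hq F _).2 hVA.self_of_nhds
  have hℓ : ContDiffAt ℝ ∞ ℓ (φ q, v) :=
    (contDiffOn_chartLagrangian F p).contDiffAt ((isOpen_chartDomain F p).mem_nhds hmem)
  have hd2 : DifferentiableAt ℝ (fderiv ℝ (fderiv ℝ ℓ)) (φ q, v) :=
    (contDiffAt_fderiv (contDiffAt_fderiv hℓ)).differentiableAt (by simp)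
  have hYd := differentiableAt_comp_extChartAt_symm hq (mdifferentiableAt_fieldCoord hq hY)
  have hZd := differentiableAt_comp_extChartAt_symm hq (mdifferentiableAt_fieldCoord hq hZ)
  have hpair : HasFDerivAt (fun y : E => (y, v)) (ContinuousLinearMap.inl ℝ E E) (φ q) :=
    (hasFDerivAt_id (𝕜 := ℝ) (φ q)).prodMk (hasFDerivAt_const v (φ q))
  have hYp := (hasFDerivAt_const (0 : E) (φ q)).prodMk hYd.hasFDerivAt
  have hZp := (hasFDerivAt_const (0 : E) (φ q)).prodMk hZd.hasFDerivAt
  obtain ⟨hH, hHf⟩ := fderiv_clm_apply₂ (c := fun y : E => (y, v)) hd2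
    hpair.differentiableAt hYp.differentiableAt hZp.differentiableAt
  have hcont : Filter.Tendsto φ.symm (𝓝 (φ q)) (𝓝 q) := by
    have := (continuousAt_extChartAt_symm' (I := 𝓘(ℝ, E)) hqs).tendsto
    rwa [← hφ, hinv] at this
  have ev : (fun q => fundamentalTensor F.L (V q) (Y q) (Z q)) ∘ φ.symm =ᶠ[𝓝 (φ q)] fun y =>
      (1 / 2) * (fderiv ℝ (fderiv ℝ ℓ) (y, v) (0, (fieldCoord p Y ∘ φ.symm) y)
        (0, (fieldCoord p Z ∘ φ.symm) y)) := by
    filter_upwards [hcont.eventually hVc, hcont.eventually hVA,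
      (isOpen_extChartAt_target p).mem_nhds (φ.map_source hqs)] with y hy1 hy2 hy3
    have hs : φ.symm y ∈ (chartAt E p).source := by simpa [hφ] using φ.map_target hy3
    simp only [Function.comp_apply]
    rw [fundamentalTensor_eq hs hy2, φ.right_inv hy3]
    simp only [fieldCoord] at hy1 ⊢
    rw [hy1]
  have hH' := (hH.const_mul (1 / 2)).congr_of_eventuallyEq ev
  rw [mvfderiv_eq_fderiv_comp_symm hq hH', ev.fderiv_eq, fderiv_const_mul hH, fieldDeriv,
    fieldDeriv, mvfderiv_eq_fderiv_comp_symm hq hYd, mvfderiv_eq_fderiv_comp_symm hq hZd, ← hφ,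
    smul_apply, hHf, hpair.fderiv, hYp.fderiv, hZp.fderiv]
  simp only [← hφ, Function.comp_apply, hinv, ContinuousLinearMap.inl_apply,
    ContinuousLinearMap.prod_apply, zero_apply, smul_eq_mul]

end FieldsInChart

section Chern

variable (F : PseudoFinslerMetric E M) {p : M} (w : TangentSpace 𝓘(ℝ, E) p)

/-- The points of the chart domain at `p` at which the extension of `w` is admissible. -/
def admissibleDomain : Set M :=
  {q | q ∈ (chartAt E p).source ∧
    (⟨q, FiberBundle.extend E w q⟩ : TangentBundle 𝓘(ℝ, E) M) ∈ F.A}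

lemma isOpen_admissibleDomain : IsOpen (admissibleDomain F w) :=
  (isSmoothFieldOn_extend w).continuousOn.isOpen_inter_preimage (chartAt E p).open_source
    F.isOpen_A

variable {F w}

lemma IsSmoothFieldOn.mdifferentiableAt {X : Π q : M, TangentSpace 𝓘(ℝ, E) q} {Ω : Set M}
    (hX : IsSmoothFieldOn X Ω) (hΩ : IsOpen Ω) {q : M} (hq : q ∈ Ω) :
    MDifferentiableAt 𝓘(ℝ, E) 𝓘(ℝ, E).tangent
      (fun q => (⟨q, X q⟩ : TangentBundle 𝓘(ℝ, E) M)) q :=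
  (hX.contMDiffAt (hΩ.mem_nhds hq)).mdifferentiableAt (by simp)

lemma fieldDeriv_extend {q : M} (hq : q ∈ (chartAt E p).source) :
    fieldDeriv p (FiberBundle.extend E w) q = 0 := by
  have h := (fieldCoord_extend_eventuallyEq hq w).mfderiv_eq (I := 𝓘(ℝ, E)) (I' := 𝓘(ℝ, E))
  change mfderiv 𝓘(ℝ, E) 𝓘(ℝ, E) (fieldCoord p (FiberBundle.extend E w)) q = 0
  rw [h]
  exact mfderiv_const

set_option synthInstance.maxHeartbeats 200000 in
/-- The Christoffel symbols, as bilinear maps, at the points of the admissible domain. -/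
lemma exists_christoffel_form {q : M} (hq : q ∈ admissibleDomain F w) :
    ∃ Γ : E →L[ℝ] E →L[ℝ] E, (∀ x y, Γ x y = Γ y x) ∧ ∀ x y z : E,
      fderiv ℝ (fderiv ℝ (fderiv ℝ (chartLagrangian F p)))
          (extChartAt 𝓘(ℝ, E) p q, vecCoord p p w) (x, 0) (0, y) (0, z) =
        fderiv ℝ (fderiv ℝ (chartLagrangian F p)) (extChartAt 𝓘(ℝ, E) p q, vecCoord p p w)
          (0, Γ x y) (0, z) +
        fderiv ℝ (fderiv ℝ (chartLagrangian F p)) (extChartAt 𝓘(ℝ, E) p q, vecCoord p p w)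
          (0, y) (0, Γ x z) +
        fderiv ℝ (fderiv ℝ (fderiv ℝ (chartLagrangian F p)))
          (extChartAt 𝓘(ℝ, E) p q, vecCoord p p w) (0, Γ x (vecCoord p p w)) (0, y) (0, z) := by
  have hO := isOpen_chartDomain F p
  have hℓ := contDiffOn_chartLagrangian F p
  have hom := chartLagrangian_smul F p
  have hv : vecCoord p q (FiberBundle.extend E w q) = vecCoord p p w := fieldCoord_extend hq.1 w
  have hz : (extChartAt 𝓘(ℝ, E) p q, vecCoord p p w) ∈ chartDomain F p := by
    rw [← hv]; exact (mem_chartDomain_iff hq.1 F _).2 hq.2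
  have hnd : ∀ u : E, (∀ y : E, fderiv ℝ (fderiv ℝ (chartLagrangian F p))
      (extChartAt 𝓘(ℝ, E) p q, vecCoord p p w) (0, u) (0, y) = 0) → u = 0 := by
    intro u hu
    have := F.nondegenerate q _ hq.2 (vecOfCoord p q u) fun y => by
      rw [fundamentalTensor_eq hq.1 hq.2, hv, vecCoord_vecOfCoord hq.1, hu, mul_zero]
    rw [← vecCoord_vecOfCoord hq.1 u, this, map_zero]
  set v := vecCoord p p w
  set ℓ := chartLagrangian F p
  set z := (extChartAt 𝓘(ℝ, E) p q, v)
  have hzℓ : ContDiffAt ℝ ∞ ℓ z := hℓ.contDiffAt (hO.mem_nhds hz)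
  let j := ContinuousLinearMap.inr ℝ E E
  let g : E →L[ℝ] E →L[ℝ] ℝ := ((fderiv ℝ (fderiv ℝ ℓ) z).bilinearComp j j)
  have hg : ∀ x y, g x y = fderiv ℝ (fderiv ℝ ℓ) z (0, x) (0, y) := fun x y => rfl
  have j_add : ∀ a b : E, ((0 : E), a + b) = (0, a) + (0, b) := fun a b => by simp
  have j_smul : ∀ (r : ℝ) (b : E), ((0 : E), r • b) = r • (0, b) := fun a b => by simp
  have i_add : ∀ a b : E, (a + b, (0 : E)) = (a, 0) + (b, 0) := fun a b => by simp
  have i_smul : ∀ (r : ℝ) (b : E), (r • b, (0 : E)) = r • (b, 0) := fun a b => by simp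
  -- Here `g`, its derivative and `C` are twice the geometric tensors; the relation is linear in the
  -- three together, so the common factor is harmless.
  obtain ⟨Γ, hs, hΓ⟩ := exists_chern_christoffel g
    (fun x y z' => fderiv ℝ (fderiv ℝ (fderiv ℝ ℓ)) z (x, 0) (0, y) (0, z'))
    (fun x y z' => (1 / 2) * fderiv ℝ (fderiv ℝ (fderiv ℝ ℓ)) z (0, x) (0, y) (0, z')) v
    hnd (fun x y => fderiv_fderiv_symm hzℓ _ _)
    (fun y z => ⟨fun a b => by simp only [i_add, map_add, add_apply],
      fun r b => by simp only [i_smul, map_smul, smul_apply]⟩)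
    (fun y z => ⟨fun a b => by simp only [j_add, map_add],
      fun r b => by simp only [j_smul, map_smul]⟩)
    (fun y z => ⟨fun a b => by simp only [j_add, map_add, mul_add],
      fun r b => by simp only [j_smul, map_smul, smul_eq_mul]; ring⟩)
    (fun x y z => fderiv_fderiv_fderiv_symm hO hℓ hz _ _ _)
    (fun x y z => by rw [fderiv_fderiv_symm (contDiffAt_fderiv hzℓ)])
    (fun x y z => by rw [fderiv_fderiv_fderiv_symm hO hℓ hz])
    -- C_v(·, ·, v) = 0: for a vertical direction the two Hessian terms of the differentiated Euler
    -- relation cancel.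
    (fun x y => by
      have := fderiv_fderiv_fderiv_fiber_self hO hℓ hom hz (0, x) y
      rw [this]; simp)
  refine ⟨Γ, hs, fun x y z' => ?_⟩
  rw [← hg, ← hg, hΓ]
  ring

open Classical in
/-- A choice of the Christoffel symbols. -/
def christoffelForm (F : PseudoFinslerMetric E M) {p : M} (w : TangentSpace 𝓘(ℝ, E) p) (q : M) :
    E →L[ℝ] E →L[ℝ] E :=
  if hq : q ∈ admissibleDomain F w then (exists_christoffel_form hq).choose else 0

/-- The Chern connection on the admissible domain. -/
def chartConnection (F : PseudoFinslerMetric E M) {p : M} (w : TangentSpace 𝓘(ℝ, E) p)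
    (Y : Π q : M, TangentSpace 𝓘(ℝ, E) q) (q : M) :
    TangentSpace 𝓘(ℝ, E) q →L[ℝ] TangentSpace 𝓘(ℝ, E) q :=
  (vecOfCoord p q).comp
    (fieldDeriv p Y q + (christoffelForm F w q (fieldCoord p Y q)).comp (vecCoord p q))

lemma vecCoord_chartConnection {q : M} (hq : q ∈ (chartAt E p).source)
    (Y : Π q : M, TangentSpace 𝓘(ℝ, E) q) (u : TangentSpace 𝓘(ℝ, E) q) :
    vecCoord p q (chartConnection F w Y q u) =
      fieldDeriv p Y q u + christoffelForm F w q (fieldCoord p Y q) (vecCoord p q u) :=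
  vecCoord_vecOfCoord hq _

/-- The connection is dY + Γ(Y, ·) in components: the Leibniz rule comes from d, torsion-freeness
from the symmetry of Γ, and almost-compatibility from the identity defining Γ, since the reference
field has constant components. Γ is chosen point by point; the axioms ask for no regularity in the
point. -/
lemma isChernConnection_chartConnection :
    IsChernConnection F (admissibleDomain F w) (FiberBundle.extend E w)
      (chartConnection F w) := by
  have hΩ := isOpen_admissibleDomain F w
  refine ⟨⟨?_, ?_⟩, ?_, ?_⟩
  · intro X Y q hX hY hq
    have hX' := mdifferentiableAt_fieldCoord hq.1 hX
    have hY' := mdifferentiableAt_fieldCoord hq.1 hY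
    have e1 : fieldCoord p (X + Y) = fieldCoord p X + fieldCoord p Y := by
      ext q; simp [fieldCoord]
    have e2 : fieldDeriv p (X + Y) q = fieldDeriv p X q + fieldDeriv p Y q := by
      rw [fieldDeriv, e1, mvfderiv_add hX' hY']; rfl
    ext u
    simp only [chartConnection, e1, e2, Pi.add_apply, map_add]
    simp only [ContinuousLinearMap.comp_apply, add_apply, map_add]
    abel
  · intro X f q hX hf hq
    have hX' := mdifferentiableAt_fieldCoord hq.1 hX
    have e1 : fieldCoord p (f • X) = f • fieldCoord p X := by
      ext q; simp [fieldCoord]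
    have e2 : fieldDeriv p (f • X) q = f q • fieldDeriv p X q +
        (mvfderiv 𝓘(ℝ, E) f q).smulRight (fieldCoord p X q) := by
      rw [fieldDeriv, e1, mvfderiv_smul hf hX']; rfl
    ext u
    have e3 := vecOfCoord_vecCoord hq.1 (X q)
    simp only [chartConnection, e1, e2, Pi.smul_apply', map_smul]
    simp only [ContinuousLinearMap.comp_apply, add_apply, map_add, smul_apply, map_smul,
      ContinuousLinearMap.smulRight_apply, fieldCoord, e3, smul_add]
    abel
  · intro X Y hX hY q hq
    have hX' := hX.mdifferentiableAt hΩ hq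
    have hY' := hY.mdifferentiableAt hΩ hq
    have hs : ∀ x y, christoffelForm F w q x y = christoffelForm F w q y x := by
      rw [christoffelForm, dif_pos hq]; exact (exists_christoffel_form hq).choose_spec.1
    rw [← vecOfCoord_vecCoord hq.1 (VectorField.mlieBracket 𝓘(ℝ, E) X Y q),
      ← vecOfCoord_vecCoord hq.1 (chartConnection F w Y q (X q) - chartConnection F w X q (Y q)),
      vecCoord_mlieBracket hq.1 hX' hY', map_sub, vecCoord_chartConnection hq.1,
      vecCoord_chartConnection hq.1]
    congr 1
    simp only [fieldCoord]
    rw [hs (vecCoord p q (X q))]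
    abel
  · intro X Y Z hX hY hZ q hq
    have hY' := hY.mdifferentiableAt hΩ hq
    have hZ' := hZ.mdifferentiableAt hΩ hq
    have hs : ∀ x y, christoffelForm F w q x y = christoffelForm F w q y x := by
      rw [christoffelForm, dif_pos hq]; exact (exists_christoffel_form hq).choose_spec.1
    have hc := (exists_christoffel_form hq).choose_spec.2
    have hΓ : (exists_christoffel_form hq).choose = christoffelForm F w q := by
      rw [christoffelForm, dif_pos hq]
    rw [hΓ] at hc
    have hv : vecCoord p q (FiberBundle.extend E w q) = vecCoord p p w := fieldCoord_extend hq.1 w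
    have main := mvfderiv_fundamentalTensor hq.1 (fieldCoord_extend_eventuallyEq hq.1 w)
      (by filter_upwards [hΩ.mem_nhds hq] with y hy using hy.2) hY' hZ' (X q)
    suffices mvfderiv 𝓘(ℝ, E)
          (fun q => fundamentalTensor F.L (FiberBundle.extend E w q) (Y q) (Z q)) q (X q) =
        fundamentalTensor F.L (FiberBundle.extend E w q) (chartConnection F w Y q (X q)) (Z q) +
        fundamentalTensor F.L (FiberBundle.extend E w q) (Y q) (chartConnection F w Z q (X q)) +
        2 * cartanTensor F.L (FiberBundle.extend E w q)
          (chartConnection F w (FiberBundle.extend E w) q (X q)) (Y q) (Z q) from this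
    rw [main, fundamentalTensor_eq hq.1 hq.2, fundamentalTensor_eq hq.1 hq.2,
      cartanTensor_eq hq.1 hq.2, vecCoord_chartConnection hq.1,
      vecCoord_chartConnection hq.1, vecCoord_chartConnection hq.1,
      hv, hc, fieldDeriv_extend hq.1, fieldCoord_extend hq.1, hs _ (vecCoord p q (X q)),
      hs _ (vecCoord p q (X q)), hs _ (vecCoord p q (X q))]
    have j_add : ∀ a b : E, ((0 : E), a + b) = (0, a) + (0, b) := fun a b => by simp
    simp only [j_add, map_add, add_apply, zero_apply, zero_add, fieldCoord]
    ring

/-- Definitionally the compatibility axiom, but with a derivative valued in ℝ instead of a tangent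
space of ℝ. -/
lemma IsChernConnection.mvfderiv_fundamentalTensor {Ω : Set M} {V : Π q : M, TangentSpace 𝓘(ℝ, E) q}
    {cov : (Π p : M, TangentSpace 𝓘(ℝ, E) p) →
      (Π p : M, TangentSpace 𝓘(ℝ, E) p →L[ℝ] TangentSpace 𝓘(ℝ, E) p)}
    (H : IsChernConnection F Ω V cov) {X Y Z : Π q : M, TangentSpace 𝓘(ℝ, E) q}
    (hX : IsSmoothFieldOn X Ω) (hY : IsSmoothFieldOn Y Ω) (hZ : IsSmoothFieldOn Z Ω)
    {q : M} (hq : q ∈ Ω) :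
    mvfderiv 𝓘(ℝ, E) (fun q => fundamentalTensor F.L (V q) (Y q) (Z q)) q (X q) =
      fundamentalTensor F.L (V q) (cov Y q (X q)) (Z q) +
      fundamentalTensor F.L (V q) (Y q) (cov Z q (X q)) +
      2 * cartanTensor F.L (V q) (cov V q (X q)) (Y q) (Z q) :=
  H.almost_compatible X Y Z hX hY hZ q hq

lemma isChernConnection_chernConnection :
    IsChernConnection F (admissibleDomain F w) (FiberBundle.extend E w)
      (chernConnection F (admissibleDomain F w) (FiberBundle.extend E w)) := by
  have h : ∃ cov, IsChernConnection F (admissibleDomain F w) (FiberBundle.extend E w) cov :=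
    ⟨_, isChernConnection_chartConnection⟩
  rw [chernConnection, dif_pos h]
  exact h.choose_spec

/-- The Koszul formula for `g_w(∇_W W, z)`, where `W` is the field with constant components that
extends `w`. -/
lemma fundamentalTensor_christoffel_self (hw : (⟨p, w⟩ : TangentBundle 𝓘(ℝ, E) M) ∈ F.A)
    (z : TangentSpace 𝓘(ℝ, E) p) :
    fundamentalTensor F.L w (christoffel F w w w) z =
      (1 / 2) * (fderiv ℝ (fderiv ℝ (chartLagrangian F p)) (extChartAt 𝓘(ℝ, E) p p, vecCoord p p w)
          (vecCoord p p w, 0) (0, vecCoord p p z) -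
        fderiv ℝ (chartLagrangian F p) (extChartAt 𝓘(ℝ, E) p p, vecCoord p p w)
          (vecCoord p p z, 0)) := by
  have hΩ := isOpen_admissibleDomain F w
  have hp : p ∈ admissibleDomain F w := ⟨mem_chart_source E p, by simpa using hw⟩
  have hps := hp.1
  have hO := isOpen_chartDomain F p
  have hℓ := contDiffOn_chartLagrangian F p
  have hom := chartLagrangian_smul F p
  have hz : (extChartAt 𝓘(ℝ, E) p p, vecCoord p p w) ∈ chartDomain F p :=
    (mem_chartDomain_iff hps F _).2 hw
  have hzℓ := hℓ.contDiffAt (hO.mem_nhds hz)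
  have H := isChernConnection_chernConnection (F := F) (w := w)
  have smV : ∀ x : TangentSpace 𝓘(ℝ, E) p,
      IsSmoothFieldOn (FiberBundle.extend E x) (admissibleDomain F w) :=
    fun x => (isSmoothFieldOn_extend x).mono fun q hq => hq.1
  -- Fields with constant components commute, so ∇_W Z = ∇_Z W. Compatibility for (W, W, Z) and for
  -- (Z, W, W) then determines g(∇_W W, z).
  have hT := H.torsion_free _ _ (smV w) (smV z) p hp
  have hC₁ := H.mvfderiv_fundamentalTensor (smV w) (smV w) (smV z) hp
  have hC₂ := H.mvfderiv_fundamentalTensor (smV z) (smV w) (smV w) hp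
  have hA : ∀ᶠ q in 𝓝 p,
      (⟨q, FiberBundle.extend E w q⟩ : TangentBundle 𝓘(ℝ, E) M) ∈ F.A := by
    filter_upwards [hΩ.mem_nhds hp] with y hy using hy.2
  have hd := fun x => (smV x).mdifferentiableAt hΩ hp
  have hbr : VectorField.mlieBracket 𝓘(ℝ, E) (FiberBundle.extend E w) (FiberBundle.extend E z) p
      = 0 := by
    rw [← vecOfCoord_vecCoord hps (VectorField.mlieBracket _ _ _ p),
      vecCoord_mlieBracket hps (hd w) (hd z), fieldDeriv_extend hps, fieldDeriv_extend hps]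
    simp
  have D₁ := mvfderiv_fundamentalTensor hps (fieldCoord_extend_eventuallyEq hps w) hA (hd w) (hd z)
    (FiberBundle.extend E w p)
  have D₂ := mvfderiv_fundamentalTensor hps (fieldCoord_extend_eventuallyEq hps w) hA (hd w) (hd w)
    (FiberBundle.extend E z p)
  have hC₁' := D₁.symm.trans hC₁
  have hC₂' := D₂.symm.trans hC₂
  simp only [FiberBundle.extend_apply_self, fieldDeriv_extend hps, fieldCoord_extend hps,
    hbr] at hT hC₁' hC₂'
  have hchr : christoffel F w w w =
      chernConnection F (admissibleDomain F w) (FiberBundle.extend E w)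
        (FiberBundle.extend E w) p w :=
    rfl
  rw [hchr]
  set cov := chernConnection F (admissibleDomain F w) (FiberBundle.extend E w)
  rw [sub_eq_zero] at hT
  rw [hT] at hC₁'
  rw [cartanTensor_eq hps hw] at hC₁' hC₂'
  simp only [fundamentalTensor_eq hps hw] at hC₁' hC₂' ⊢
  set v := vecCoord p p w
  set y := vecCoord p p z
  set x := extChartAt 𝓘(ℝ, E) p p
  have E0 : ((0 : E), (0 : E)) = 0 := rfl
  have E1 := fderiv_fderiv_fderiv_fiber_self hO hℓ hom hz
  have E2 := fderiv_fderiv_fiber_self hO hℓ hom hz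
  have S3 := fun a b c => fderiv_fderiv_fderiv_symm hO hℓ hz a b c
  have S2 := fun a b => fderiv_fderiv_symm hzℓ a b
  simp only at E1 E2
  -- The swap moves `v` to the last slot, where Euler's relation applies. It is made twice because
  -- the first slot differs between the metric derivative and the Cartan term.
  rw [S3 _ (0, v) (0, y)] at hC₁'
  rw [S3 _ (0, v) (0, y)] at hC₁'
  simp only [E1, E0, zero_apply, map_zero, S2 (0, v), E2, sub_zero, sub_self] at hC₁' hC₂'
  linarith

end Chern

end PseudoFinsler

/-! ### Integrals over a closed strip -/

namespace PseudoFinsler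

section ParametricIntegral

variable {c d ε : ℝ} (hcd : c < d) (hε : 0 < ε) {f : ℝ × ℝ → ℝ}
  (hf : ContDiffOn ℝ ∞ f (Icc c d ×ˢ Ioo (-ε) ε))

/-- The strip `[c, d] × (-ε, ε)`. -/
abbrev strip (c d ε : ℝ) : Set (ℝ × ℝ) := Icc c d ×ˢ Ioo (-ε) ε

include hcd in
lemma uniqueDiffOn_strip : UniqueDiffOn ℝ (strip c d ε) :=
  (uniqueDiffOn_Icc hcd).prod isOpen_Ioo.uniqueDiffOn

include hcd hf in
lemma intervalIntegrable_slice {s : ℝ} (hs : s ∈ Ioo (-ε) ε) :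
    IntervalIntegrable (fun τ => f (τ, s)) volume c d := by
  apply ContinuousOn.intervalIntegrable
  rw [uIcc_of_le hcd.le]
  exact hf.continuousOn.comp (by fun_prop) fun τ hτ => ⟨hτ, hs⟩

include hcd hf in
lemma contDiffOn_fderivWithin_strip (u : ℝ × ℝ) :
    ContDiffOn ℝ ∞ (fun z => fderivWithin ℝ f (strip c d ε) z u) (strip c d ε) :=
  (hf.fderivWithin (uniqueDiffOn_strip hcd) (by simp)).clm_apply contDiffOn_const

include hcd hε hf in
/-- Differentiation under the integral sign on a closed strip. -/
lemma hasDerivAt_integral_strip :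
    HasDerivAt (fun s => ∫ τ in c..d, f (τ, s))
      (∫ τ in c..d, fderivWithin ℝ f (strip c d ε) (τ, 0) (0, 1)) 0 := by
  have h0 : (0 : ℝ) ∈ Ioo (-ε) ε := ⟨by linarith, hε⟩
  have hd := contDiffOn_fderivWithin_strip hcd hf (0, 1)
  -- Halving the width in `s` gives a compact set, hence a constant that dominates the
  -- `s`-derivative.
  have hK : IsCompact (Icc c d ×ˢ Icc (-(ε / 2)) (ε / 2)) := isCompact_Icc.prod isCompact_Icc
  have hKS : Icc c d ×ˢ Icc (-(ε / 2)) (ε / 2) ⊆ strip c d ε := fun z hz =>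
    ⟨hz.1, by linarith [hz.2.1], by linarith [hz.2.2]⟩
  obtain ⟨C, hC⟩ := hK.exists_bound_of_continuousOn (hd.continuousOn.mono hKS)
  have hmeas : ∀ {g : ℝ × ℝ → ℝ}, ContDiffOn ℝ ∞ g (strip c d ε) → ∀ s ∈ Ioo (-ε) ε,
      AEStronglyMeasurable (fun τ => g (τ, s)) (volume.restrict (uIoc c d)) := fun hg s hs =>
    (intervalIntegrable_slice hcd hg hs).aestronglyMeasurable_restrict_uIoc
  have hnear : ∀ᶠ s in 𝓝 (0 : ℝ), s ∈ Ioo (-ε) ε := isOpen_Ioo.mem_nhds h0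
  refine (intervalIntegral.hasDerivAt_integral_of_dominated_loc_of_deriv_le
    (F := fun s τ => f (τ, s)) (F' := fun s τ => fderivWithin ℝ f (strip c d ε) (τ, s) (0, 1))
    (s := Ioo (-(ε / 2)) (ε / 2)) (bound := fun _ => C)
    (isOpen_Ioo.mem_nhds ⟨by linarith, by linarith⟩)
    (hnear.mono fun s hs => hmeas hf s hs) (intervalIntegrable_slice hcd hf h0)
    (hmeas hd 0 h0) ?_ intervalIntegrable_const ?_).2
  · filter_upwards with τ hτ s hs
    rw [uIoc_of_le hcd.le] at hτ
    exact hC (τ, s) ⟨Ioc_subset_Icc_self hτ, Ioo_subset_Icc_self hs⟩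
  · filter_upwards with τ hτ s hs
    rw [uIoc_of_le hcd.le] at hτ
    have hs' : s ∈ Ioo (-ε) ε := ⟨by linarith [hs.1], by linarith [hs.2]⟩
    have hz : (τ, s) ∈ strip c d ε := ⟨Ioc_subset_Icc_self hτ, hs'⟩
    have h1 := ((hf _ hz).differentiableWithinAt (by simp)).hasFDerivWithinAt
    have h2 : HasDerivWithinAt (fun s : ℝ => (τ, s)) (0, 1) (Ioo (-ε) ε) s :=
      ((hasDerivAt_const s τ).prodMk (hasDerivAt_id s)).hasDerivWithinAt
    have := h1.comp_hasDerivWithinAt s h2 (fun s hs => ⟨hz.1, hs⟩)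
    exact this.hasDerivAt (isOpen_Ioo.mem_nhds hs')

include hcd hε hf in
-- The fundamental theorem of calculus along `s = 0`: the derivative within the strip is a true
-- derivative only for τ in the open interval, and continuity of `f` covers the two ends.
lemma integral_fderivWithin_strip :
    ∫ τ in c..d, fderivWithin ℝ f (strip c d ε) (τ, 0) (1, 0) = f (d, 0) - f (c, 0) := by
  have h0 : (0 : ℝ) ∈ Ioo (-ε) ε := ⟨by linarith, hε⟩
  refine intervalIntegral.integral_eq_sub_of_hasDerivAt_of_le (f := fun τ => f (τ, 0)) hcd.le
    (hf.continuousOn.comp (by fun_prop) fun τ hτ => ⟨hτ, h0⟩) (fun τ hτ => ?_)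
    (intervalIntegrable_slice hcd (contDiffOn_fderivWithin_strip hcd hf (1, 0)) h0)
  have hz : (τ, (0 : ℝ)) ∈ strip c d ε := ⟨Ioo_subset_Icc_self hτ, h0⟩
  have h1 := ((hf _ hz).differentiableWithinAt (by simp)).hasFDerivWithinAt
  have h2 : HasDerivWithinAt (fun τ : ℝ => (τ, (0 : ℝ))) (1, 0) (Icc c d) τ :=
    ((hasDerivAt_id τ).prodMk (hasDerivAt_const τ (0 : ℝ))).hasDerivWithinAt
  have := h1.comp_hasDerivWithinAt τ h2
    (fun τ' hτ' => show (τ', (0 : ℝ)) ∈ strip c d ε from ⟨hτ', h0⟩)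
  exact this.hasDerivAt (Icc_mem_nhds hτ.1 hτ.2)

end ParametricIntegral

/-! ### The Euler–Lagrange identity in a vector space -/

section EulerLagrange

variable {E : Type*} [NormedAddCommGroup E] [NormedSpace ℝ E] {ℓ : E × E → ℝ} {g : ℝ × ℝ → E}
  {z : ℝ × ℝ}

set_option synthInstance.maxHeartbeats 200000 in
/-- The pointwise first variation formula in a vector space. -/
lemma fderiv_lagrangian_variation (hg : ContDiffAt ℝ ∞ g z)
    (hℓ : ContDiffAt ℝ ∞ ℓ (g z, fderiv ℝ g z (1, 0))) :
    fderiv ℝ (fun y => ℓ (g y, fderiv ℝ g y (1, 0))) z (0, 1) =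
      fderiv ℝ (fun y => fderiv ℝ ℓ (g y, fderiv ℝ g y (1, 0)) (0, fderiv ℝ g y (0, 1))) z (1, 0) -
      (fderiv ℝ (fderiv ℝ ℓ) (g z, fderiv ℝ g z (1, 0))
          (fderiv ℝ g z (1, 0), fderiv ℝ (fderiv ℝ g) z (1, 0) (1, 0)) (0, fderiv ℝ g z (0, 1)) -
        fderiv ℝ ℓ (g z, fderiv ℝ g z (1, 0)) (fderiv ℝ g z (0, 1), 0)) := by
  have hgd : DifferentiableAt ℝ g z := hg.differentiableAt (by simp)
  have hdg : DifferentiableAt ℝ (fderiv ℝ g) z := (contDiffAt_fderiv hg).differentiableAt (by simp)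
  have hpart : ∀ u : ℝ × ℝ, HasFDerivAt (fun y => fderiv ℝ g y u)
      ((fderiv ℝ (fderiv ℝ g) z).flip u) z := fun u => by
    have := hdg.hasFDerivAt.clm_apply (hasFDerivAt_const u z)
    rwa [ContinuousLinearMap.comp_zero, zero_add] at this
  have hc : HasFDerivAt (fun y => (g y, fderiv ℝ g y (1, 0)))
      ((fderiv ℝ g z).prod ((fderiv ℝ (fderiv ℝ g) z).flip (1, 0))) z :=
    hgd.hasFDerivAt.prodMk (hpart _)
  have h1 := (hℓ.differentiableAt (by simp)).hasFDerivAt.comp z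
    (f := fun y => (g y, fderiv ℝ g y (1, 0))) hc
  have hdℓ : DifferentiableAt ℝ (fderiv ℝ ℓ) (g z, fderiv ℝ g z (1, 0)) :=
    (contDiffAt_fderiv hℓ).differentiableAt (by simp)
  have h2 : HasFDerivAt (fun y => fderiv ℝ ℓ (g y, fderiv ℝ g y (1, 0))) _ z :=
    hdℓ.hasFDerivAt.comp z (f := fun y => (g y, fderiv ℝ g y (1, 0))) hc
  have h3 := h2.clm_apply ((hasFDerivAt_const (0 : E) z).prodMk (hpart (0, 1)))
  erw [h1.fderiv, h3.fderiv]
  simp only [ContinuousLinearMap.comp_apply, ContinuousLinearMap.prod_apply, add_apply,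
    ContinuousLinearMap.flip_apply, zero_apply]
  -- ∂_s∂_t g = ∂_t∂_s g, the one ingredient beyond the chain and product rules.
  rw [fderiv_fderiv_symm hg (0, 1) (1, 0)]
  have e : (fderiv ℝ g z (0, 1), fderiv ℝ (fderiv ℝ g) z (1, 0) (0, 1)) =
      (fderiv ℝ g z (0, 1), (0 : E)) + (0, fderiv ℝ (fderiv ℝ g) z (1, 0) (0, 1)) := by simp
  rw [e, map_add]
  ring

end EulerLagrange

/-! ### Velocities and Lagrangian quantities on one strip -/

section Strip

variable {E : Type*} [NormedAddCommGroup E] [NormedSpace ℝ E] [FiniteDimensional ℝ E]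
  {M : Type*} [TopologicalSpace M] [ChartedSpace E M] [IsManifold 𝓘(ℝ, E) ∞ M]
  {c d ε : ℝ} (hcd : c < d) {Λ : ℝ × ℝ → M}
  (hΛ : ContMDiffOn 𝓘(ℝ, ℝ × ℝ) 𝓘(ℝ, E) ∞ Λ (strip c d ε))

/-- The derivative of `Λ`, as a map on a set `S`, in the direction `u`. -/
def partialVelocity (Λ : ℝ × ℝ → M) (S : Set (ℝ × ℝ)) (u z : ℝ × ℝ) : TangentSpace 𝓘(ℝ, E) (Λ z) :=
  mfderivWithin 𝓘(ℝ, ℝ × ℝ) 𝓘(ℝ, E) Λ S z u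

include hΛ in
lemma hasMFDerivWithinAt_slice_fst {τ s : ℝ} (hz : (τ, s) ∈ strip c d ε) :
    HasMFDerivWithinAt 𝓘(ℝ, ℝ) 𝓘(ℝ, E) (longitudinal Λ s) (Icc c d) τ
      ((mfderivWithin 𝓘(ℝ, ℝ × ℝ) 𝓘(ℝ, E) Λ (strip c d ε) (τ, s)).comp
        (ContinuousLinearMap.inl ℝ ℝ ℝ)) := by
  have h1 := ((hΛ _ hz).mdifferentiableWithinAt (by simp)).hasMFDerivWithinAt
  have h2 : HasMFDerivWithinAt 𝓘(ℝ, ℝ) 𝓘(ℝ, ℝ × ℝ) (fun τ : ℝ => (τ, s)) (Icc c d) τ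
      (ContinuousLinearMap.inl ℝ ℝ ℝ) :=
    ((hasFDerivAt_id (𝕜 := ℝ) τ).prodMk
      (hasFDerivAt_const s τ)).hasFDerivWithinAt.hasMFDerivWithinAt
  exact HasMFDerivWithinAt.comp τ (f := fun τ : ℝ => (τ, s)) h1 h2 fun τ hτ => ⟨hτ, hz.2⟩

include hΛ in
lemma hasMFDerivAt_slice_snd {τ s : ℝ} (hz : (τ, s) ∈ strip c d ε) :
    HasMFDerivAt 𝓘(ℝ, ℝ) 𝓘(ℝ, E) (fun s => Λ (τ, s)) s
      ((mfderivWithin 𝓘(ℝ, ℝ × ℝ) 𝓘(ℝ, E) Λ (strip c d ε) (τ, s)).comp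
        (ContinuousLinearMap.inr ℝ ℝ ℝ)) := by
  have h1 := ((hΛ _ hz).mdifferentiableWithinAt (by simp)).hasMFDerivWithinAt
  have h2 : HasMFDerivWithinAt 𝓘(ℝ, ℝ) 𝓘(ℝ, ℝ × ℝ) (fun s : ℝ => (τ, s)) (Ioo (-ε) ε) s
      (ContinuousLinearMap.inr ℝ ℝ ℝ) :=
    ((hasFDerivAt_const (𝕜 := ℝ) τ s).prodMk
      (hasFDerivAt_id s)).hasFDerivWithinAt.hasMFDerivWithinAt
  exact (HasMFDerivWithinAt.comp s (f := fun s : ℝ => (τ, s)) h1 h2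
    fun s hs => ⟨hz.1, hs⟩).hasMFDerivAt (isOpen_Ioo.mem_nhds hz.2)

include hΛ

/-- Restricted to the open interval: at a break the curve may fail to be differentiable, and
`velocity` is then the default 0. The derivative within the strip instead extends smoothly to both
ends, where it is the one-sided velocity. -/
lemma velocity_eq {τ s : ℝ} (hτ : τ ∈ Ioo c d) (hs : s ∈ Ioo (-ε) ε) :
    velocity (longitudinal Λ s) τ =
      (partialVelocity Λ (strip c d ε) (1, 0) (τ, s) : TangentSpace 𝓘(ℝ, E) _) := by
  have := (hasMFDerivWithinAt_slice_fst hΛ ⟨Ioo_subset_Icc_self hτ, hs⟩).hasMFDerivAt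
    (Icc_mem_nhds hτ.1 hτ.2)
  rw [velocity, this.mfderiv]
  rfl

lemma rightVelocity_eq {τ s : ℝ} (hτ : τ ∈ Ico c d) (hs : s ∈ Ioo (-ε) ε) :
    rightVelocity (longitudinal Λ s) τ =
      (partialVelocity Λ (strip c d ε) (1, 0) (τ, s) : TangentSpace 𝓘(ℝ, E) _) := by
  have := (hasMFDerivWithinAt_slice_fst hΛ ⟨Ico_subset_Icc_self hτ, hs⟩).mono_of_mem_nhdsWithin
    (t := Ici τ) (Icc_mem_nhdsGE_of_mem hτ)
  rw [rightVelocity, this.mfderivWithin (uniqueMDiffWithinAt_iff_uniqueDiffWithinAt.2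
    (uniqueDiffWithinAt_Ici τ))]
  rfl

lemma leftVelocity_eq {τ s : ℝ} (hτ : τ ∈ Ioc c d) (hs : s ∈ Ioo (-ε) ε) :
    leftVelocity (longitudinal Λ s) τ =
      (partialVelocity Λ (strip c d ε) (1, 0) (τ, s) : TangentSpace 𝓘(ℝ, E) _) := by
  have := (hasMFDerivWithinAt_slice_fst hΛ ⟨Ioc_subset_Icc_self hτ, hs⟩).mono_of_mem_nhdsWithin
    (t := Iic τ) (Icc_mem_nhdsLE_of_mem hτ)
  rw [leftVelocity, this.mfderivWithin (uniqueMDiffWithinAt_iff_uniqueDiffWithinAt.2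
    (uniqueDiffWithinAt_Iic τ))]
  rfl

/-- Valid on the closed interval, as `s = 0` is interior to (-ε, ε). So the strips on both sides of
a break give the same vector there. -/
lemma variationField_eq {τ : ℝ} (hτ : τ ∈ Icc c d) (hε : 0 < ε) :
    variationField Λ τ =
      (partialVelocity Λ (strip c d ε) (0, 1) (τ, 0) : TangentSpace 𝓘(ℝ, E) _) := by
  have := hasMFDerivAt_slice_snd hΛ (τ := τ) (s := 0) ⟨hτ, by linarith, hε⟩
  rw [variationField, this.mfderiv]
  rfl

lemma contDiffWithinAt_extChartAt_comp {p : M} {z : ℝ × ℝ} (hz : z ∈ strip c d ε)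
    (hp : Λ z ∈ (chartAt E p).source) :
    ContDiffWithinAt ℝ ∞ (extChartAt 𝓘(ℝ, E) p ∘ Λ) (strip c d ε) z := by
  rw [← contMDiffWithinAt_iff_contDiffWithinAt]
  exact (contMDiffAt_extChartAt' hp).comp_contMDiffWithinAt z (hΛ z hz)

include hcd in
lemma vecCoord_partialVelocity {p : M} {z : ℝ × ℝ} (hz : z ∈ strip c d ε)
    (hp : Λ z ∈ (chartAt E p).source) (u : ℝ × ℝ) :
    vecCoord p (Λ z) (partialVelocity Λ (strip c d ε) u z) =
      fderivWithin ℝ (extChartAt 𝓘(ℝ, E) p ∘ Λ) (strip c d ε) z u := by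
  have h1 := ((hΛ _ hz).mdifferentiableWithinAt (by simp)).hasMFDerivWithinAt
  have h2 := (mdifferentiableAt_extChartAt (I := 𝓘(ℝ, E)) hp).hasMFDerivAt
  have h3 := (h2.comp_hasMFDerivWithinAt z h1).hasFDerivWithinAt
  have h4 := HasFDerivWithinAt.fderivWithin (𝕜 := ℝ) (E := ℝ × ℝ) (F := E) h3
    (uniqueDiffOn_strip hcd z hz)
  rw [vecCoord_eq_mfderiv hp]
  exact (DFunLike.congr_fun h4 u).symm

lemma eventually_mem_chart_source {p : M} {z : ℝ × ℝ} (hz : z ∈ strip c d ε)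
    (hp : Λ z ∈ (chartAt E p).source) :
    ∀ᶠ y in 𝓝[strip c d ε] z, Λ y ∈ (chartAt E p).source :=
  (hΛ.continuousOn z hz).eventually ((chartAt E p).open_source.mem_nhds hp)

variable {F : PseudoFinslerMetric E M}
  (hA : ∀ z ∈ strip c d ε, (⟨Λ z, partialVelocity Λ (strip c d ε) (1, 0) z⟩ :
    TangentBundle 𝓘(ℝ, E) M) ∈ F.A)

include hcd hA

lemma mem_chartDomain_partialVelocity {p : M} {z : ℝ × ℝ} (hz : z ∈ strip c d ε)
    (hp : Λ z ∈ (chartAt E p).source) :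
    ((extChartAt 𝓘(ℝ, E) p ∘ Λ) z,
      fderivWithin ℝ (extChartAt 𝓘(ℝ, E) p ∘ Λ) (strip c d ε) z (1, 0)) ∈ chartDomain F p := by
  rw [← vecCoord_partialVelocity hcd hΛ hz hp]
  exact (mem_chartDomain_iff hp F _).2 (hA z hz)

lemma lagrangian_partialVelocity_eq {p : M} {z : ℝ × ℝ} (hz : z ∈ strip c d ε)
    (hp : Λ z ∈ (chartAt E p).source) :
    F.L ⟨Λ z, partialVelocity Λ (strip c d ε) (1, 0) z⟩ =
      chartLagrangian F p ((extChartAt 𝓘(ℝ, E) p ∘ Λ) z,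
        fderivWithin ℝ (extChartAt 𝓘(ℝ, E) p ∘ Λ) (strip c d ε) z (1, 0)) := by
  rw [← vecCoord_partialVelocity hcd hΛ hz hp, ← chartLagrangian_vecCoord hp]
  rfl

/-- By Euler's relation this is the momentum ½ ∂_vℓ paired with ∂_sΛ, the quantity whose
`t`-derivative appears in the variation formula. -/
lemma fundamentalTensor_partialVelocity_eq {p : M} {z : ℝ × ℝ} (hz : z ∈ strip c d ε)
    (hp : Λ z ∈ (chartAt E p).source) :
    fundamentalTensor F.L (partialVelocity Λ (strip c d ε) (1, 0) z)
        (partialVelocity Λ (strip c d ε) (0, 1) z) (partialVelocity Λ (strip c d ε) (1, 0) z) =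
      (1 / 2) * fderiv ℝ (chartLagrangian F p) ((extChartAt 𝓘(ℝ, E) p ∘ Λ) z,
        fderivWithin ℝ (extChartAt 𝓘(ℝ, E) p ∘ Λ) (strip c d ε) z (1, 0))
        (0, fderivWithin ℝ (extChartAt 𝓘(ℝ, E) p ∘ Λ) (strip c d ε) z (0, 1)) := by
  have h := mem_chartDomain_partialVelocity hcd hΛ hA hz hp
  rw [fundamentalTensor_eq hp (hA z hz), vecCoord_partialVelocity hcd hΛ hz hp,
    vecCoord_partialVelocity hcd hΛ hz hp]
  congr 1
  exact fderiv_fderiv_fiber_self' (isOpen_chartDomain F p) (contDiffOn_chartLagrangian F p)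
    (chartLagrangian_smul F p) h _

/-- Smoothness is local and the function does not depend on a chart, so at each `z` the chart at `Λ
z` is enough. -/
lemma contDiffOn_lagrangian_partialVelocity :
    ContDiffOn ℝ ∞ (fun z => F.L ⟨Λ z, partialVelocity Λ (strip c d ε) (1, 0) z⟩)
      (strip c d ε) := by
  intro z hz
  have hp := mem_chart_source E (Λ z)
  have hg := contDiffWithinAt_extChartAt_comp hΛ hz hp
  have hdg := (hg.fderivWithin_right (m := ∞) (uniqueDiffOn_strip hcd) (by simp) hz).clm_apply
    (contDiffWithinAt_const (c := ((1 : ℝ), (0 : ℝ))))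
  have hm := mem_chartDomain_partialVelocity hcd hΛ hA hz hp
  have hℓ := (contDiffOn_chartLagrangian F (Λ z)).contDiffAt
    ((isOpen_chartDomain F (Λ z)).mem_nhds hm)
  refine (hℓ.comp_contDiffWithinAt z (hg.prodMk hdg)).congr_of_eventuallyEq_of_mem ?_ hz
  filter_upwards [eventually_mem_chart_source hΛ hz hp, self_mem_nhdsWithin] with y hy hyS
  exact lagrangian_partialVelocity_eq hcd hΛ hA hyS hy

lemma contDiffOn_fundamentalTensor_partialVelocity :
    ContDiffOn ℝ ∞ (fun z => fundamentalTensor F.L (partialVelocity Λ (strip c d ε) (1, 0) z)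
        (partialVelocity Λ (strip c d ε) (0, 1) z) (partialVelocity Λ (strip c d ε) (1, 0) z))
      (strip c d ε) := by
  intro z hz
  have hp := mem_chart_source E (Λ z)
  have hg := contDiffWithinAt_extChartAt_comp hΛ hz hp
  have hdg := fun u : ℝ × ℝ => (hg.fderivWithin_right (m := ∞) (uniqueDiffOn_strip hcd) (by simp)
    hz).clm_apply (contDiffWithinAt_const (c := u))
  have hm := mem_chartDomain_partialVelocity hcd hΛ hA hz hp
  have hℓ := contDiffAt_fderiv ((contDiffOn_chartLagrangian F (Λ z)).contDiffAt
    ((isOpen_chartDomain F (Λ z)).mem_nhds hm))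
  have h1 := (hℓ.comp_contDiffWithinAt z (hg.prodMk (hdg (1, 0)))).clm_apply
    ((contDiffWithinAt_const (c := (0 : E))).prodMk (hdg (0, 1)))
  refine ((contDiffWithinAt_const (c := (1 / 2 : ℝ))).mul h1).congr_of_eventuallyEq_of_mem ?_ hz
  filter_upwards [eventually_mem_chart_source hΛ hz hp, self_mem_nhdsWithin] with y hy hyS
  exact fundamentalTensor_partialVelocity_eq hcd hΛ hA hyS hy

/-- The Euler-Lagrange expression of the covariant derivative of the velocity. -/
lemma fundamentalTensor_covDerivAlong_velocity (hε : 0 < ε) {τ : ℝ} (hτ : τ ∈ Ioo c d) :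
    let p := Λ (τ, 0)
    let g := extChartAt 𝓘(ℝ, E) p ∘ Λ
    fundamentalTensor F.L (velocity (longitudinal Λ 0) τ) (variationField Λ τ)
        (covDerivAlong F (longitudinal Λ 0) (velocity (longitudinal Λ 0))
          (velocity (longitudinal Λ 0)) τ) =
      (1 / 2) * (fderiv ℝ (fderiv ℝ (chartLagrangian F p)) (g (τ, 0), fderiv ℝ g (τ, 0) (1, 0))
          (fderiv ℝ g (τ, 0) (1, 0), fderiv ℝ (fderiv ℝ g) (τ, 0) (1, 0) (1, 0))
          (0, fderiv ℝ g (τ, 0) (0, 1)) -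
        fderiv ℝ (chartLagrangian F p) (g (τ, 0), fderiv ℝ g (τ, 0) (1, 0))
          (fderiv ℝ g (τ, 0) (0, 1), 0)) := by
  intro p g
  have h0 : (0 : ℝ) ∈ Ioo (-ε) ε := ⟨by linarith, hε⟩
  have hz : (τ, (0 : ℝ)) ∈ strip c d ε := ⟨Ioo_subset_Icc_self hτ, h0⟩
  have hS : strip c d ε ∈ 𝓝 (τ, (0 : ℝ)) :=
    prod_mem_nhds (Icc_mem_nhds hτ.1 hτ.2) (isOpen_Ioo.mem_nhds h0)
  have hp : Λ (τ, 0) ∈ (chartAt E p).source := mem_chart_source E p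
  have hg : ContDiffAt ℝ ∞ g (τ, 0) := (contDiffWithinAt_extChartAt_comp hΛ hz hp).contDiffAt hS
  have hm := mem_chartDomain_partialVelocity hcd hΛ hA hz hp
  have hℓ := (contDiffOn_chartLagrangian F p).contDiffAt ((isOpen_chartDomain F p).mem_nhds hm)
  have hv : vecCoord p p (velocity (longitudinal Λ 0) τ) = fderiv ℝ g (τ, 0) (1, 0) := by
    rw [velocity_eq hΛ hτ h0, ← fderivWithin_of_mem_nhds hS]
    exact vecCoord_partialVelocity hcd hΛ hz hp _
  have hw : vecCoord p p (variationField Λ τ) = fderiv ℝ g (τ, 0) (0, 1) := by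
    rw [variationField_eq hΛ (Ioo_subset_Icc_self hτ) hε, ← fderivWithin_of_mem_nhds hS]
    exact vecCoord_partialVelocity hcd hΛ hz hp _
  have hvA : (⟨p, velocity (longitudinal Λ 0) τ⟩ : TangentBundle 𝓘(ℝ, E) M) ∈ F.A := by
    rw [velocity_eq hΛ hτ h0]; exact hA _ hz
  -- The trivialization stays fixed at `p` while τ' moves, so the components of the velocity are ∂_t
  -- g near τ and their derivative is the acceleration.
  have hacc : deriv (fun τ' : ℝ => (trivializationAt E (TangentSpace 𝓘(ℝ, E) : M → Type _) p
      (⟨longitudinal Λ 0 τ', velocity (longitudinal Λ 0) τ'⟩ : TangentBundle 𝓘(ℝ, E) M)).2) τ =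
      fderiv ℝ (fderiv ℝ g) (τ, 0) (1, 0) (1, 0) := by
    have hline : Filter.Tendsto (fun τ' : ℝ => (τ', (0 : ℝ))) (𝓝 τ) (𝓝 (τ, 0)) := by
      have : Continuous fun τ' : ℝ => (τ', (0 : ℝ)) := by fun_prop
      exact this.tendsto τ
    have hev : ∀ᶠ y in 𝓝 (τ, (0 : ℝ)), Λ y ∈ (chartAt E p).source := by
      have := eventually_mem_chart_source hΛ hz hp
      rwa [nhdsWithin_eq_nhds.2 hS] at this
    have ev : (fun τ' : ℝ => (trivializationAt E (TangentSpace 𝓘(ℝ, E) : M → Type _) p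
        (⟨longitudinal Λ 0 τ', velocity (longitudinal Λ 0) τ'⟩ : TangentBundle 𝓘(ℝ, E) M)).2)
        =ᶠ[𝓝 τ] fun τ' => fderiv ℝ g (τ', 0) (1, 0) := by
      filter_upwards [hline.eventually hev, isOpen_Ioo.mem_nhds hτ] with τ' h1 h2
      have hS' : strip c d ε ∈ 𝓝 (τ', (0 : ℝ)) :=
        prod_mem_nhds (Icc_mem_nhds h2.1 h2.2) (isOpen_Ioo.mem_nhds h0)
      rw [← vecCoord_apply h1, velocity_eq hΛ h2 h0, ← fderivWithin_of_mem_nhds hS']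
      exact vecCoord_partialVelocity hcd hΛ ⟨Ioo_subset_Icc_self h2, h0⟩ h1 _
    rw [ev.deriv_eq]
    have hdg : DifferentiableAt ℝ (fderiv ℝ g) (τ, 0) :=
      (contDiffAt_fderiv hg).differentiableAt (by simp)
    rw [hasDerivAt_comp_line (f := fun y => fderiv ℝ g y (1, 0)) (c := fun τ' => (τ', (0 : ℝ)))
      (w := (1, 0)) ((hasDerivAt_id τ).prodMk (hasDerivAt_const τ (0 : ℝ)))
      (hdg.clm_apply (differentiableAt_const _))]
    exact fderiv_clm_apply_const hdg _ _
  have hchr := fundamentalTensor_christoffel_self hvA (variationField Λ τ)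
  have hcov : vecCoord p p (covDerivAlong F (longitudinal Λ 0) (velocity (longitudinal Λ 0))
      (velocity (longitudinal Λ 0)) τ) = fderiv ℝ (fderiv ℝ g) (τ, 0) (1, 0) (1, 0) +
        vecCoord p p (christoffel F (velocity (longitudinal Λ 0) τ)
          (velocity (longitudinal Λ 0) τ) (velocity (longitudinal Λ 0) τ)) := by
    rw [← hacc]
    have : ∀ x : E, vecCoord p p
        ((trivializationAt E (TangentSpace 𝓘(ℝ, E) : M → Type _) p).symm p x) = x := fun x => by
      rw [← Bundle.Trivialization.symmL_apply (R := ℝ) _ (by simp)]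
      exact vecCoord_vecOfCoord hp x
    refine (map_add (vecCoord p p) _ _).trans ?_
    congr 1
    exact this _
  have hsymm := fderiv_fderiv_symm hℓ
  rw [fundamentalTensor_eq hp hvA, hv, hw] at hchr
  refine (fundamentalTensor_eq hp hvA _ _).trans ?_
  rw [hcov, hv, hw]
  have hx : extChartAt 𝓘(ℝ, E) p p = g (τ, 0) := rfl
  rw [fderivWithin_of_mem_nhds hS] at hsymm
  rw [hx] at hchr
  change (1 / 2) * fderiv ℝ (fderiv ℝ (chartLagrangian F p)) (g (τ, 0), fderiv ℝ g (τ, 0) (1, 0))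
    (0, _) (0, _) = _
  have e1 : ∀ a b : E, ((0 : E), a + b) = (0, a) + (0, b) := fun a b => by simp
  have e2 : (fderiv ℝ g (τ, 0) (1, 0), fderiv ℝ (fderiv ℝ g) (τ, 0) (1, 0) (1, 0)) =
      (fderiv ℝ g (τ, 0) (1, 0), (0 : E)) +
        (0, fderiv ℝ (fderiv ℝ g) (τ, 0) (1, 0) (1, 0)) := by simp
  rw [e1, e2, map_add, map_add, add_apply, hsymm (0, fderiv ℝ g (τ, 0) (0, 1)),
    hsymm (0, fderiv ℝ g (τ, 0) (0, 1))]
  linarith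

end Strip

end PseudoFinsler

/-! ### Summation over the strips -/

namespace PseudoFinsler

lemma integral_partition {n : ℕ} (t : Fin (n + 1) → ℝ) {f : ℝ → ℝ}
    (hf : ∀ i : Fin n, IntervalIntegrable f volume (t i.castSucc) (t i.succ)) :
    IntervalIntegrable f volume (t 0) (t (Fin.last n)) ∧
      ∑ i : Fin n, ∫ x in (t i.castSucc)..(t i.succ), f x =
        ∫ x in (t 0)..(t (Fin.last n)), f x := by
  induction n with
  | zero => simp
  | succ n ih =>
    obtain ⟨h1, h2⟩ := ih (fun i => t i.castSucc) fun i => hf i.castSucc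
    have h3 := hf (Fin.last n)
    refine ⟨h1.trans h3, ?_⟩
    rw [Fin.sum_univ_castSucc]
    exact (congrArg (· + _) h2).trans (intervalIntegral.integral_add_adjacent_intervals h1 h3)

/-- Regroups the boundary terms by node instead of by strip; `i.succ.castSucc` runs over the
interior nodes 1, …, n. -/
lemma sum_boundary_partition {n : ℕ} (l r : Fin (n + 2) → ℝ) :
    ∑ i : Fin (n + 1), (l i.succ - r i.castSucc) =
      (l (Fin.last (n + 1)) - r 0) + ∑ i : Fin n, (l i.succ.castSucc - r i.succ.castSucc) := by
  rw [Finset.sum_sub_distrib, Finset.sum_sub_distrib, Fin.sum_univ_castSucc,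
    Fin.sum_univ_succ (fun i : Fin (n + 1) => r i.castSucc)]
  simp only [Fin.succ_castSucc, Fin.succ_last, Fin.castSucc_zero]
  ring

variable {E : Type*} [NormedAddCommGroup E] [NormedSpace ℝ E] [FiniteDimensional ℝ E]
  {M : Type*} [TopologicalSpace M] [ChartedSpace E M] [IsManifold 𝓘(ℝ, E) ∞ M]
  {F : PseudoFinslerMetric E M}

lemma fundamentalTensor_symm {p : M} {v : TangentSpace 𝓘(ℝ, E) p}
    (hv : (⟨p, v⟩ : TangentBundle 𝓘(ℝ, E) M) ∈ F.A) (u w : TangentSpace 𝓘(ℝ, E) p) :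
    fundamentalTensor F.L v u w = fundamentalTensor F.L v w u := by
  have hp := mem_chart_source E p
  rw [fundamentalTensor_eq hp hv, fundamentalTensor_eq hp hv, fderiv_fderiv_symm
    ((contDiffOn_chartLagrangian F p).contDiffAt ((isOpen_chartDomain F p).mem_nhds
      ((mem_chartDomain_iff hp F v).2 hv)))]

section Strip

variable {c d ε : ℝ} (hcd : c < d) (hε : 0 < ε) {Λ : ℝ × ℝ → M}
  (hΛ : ContMDiffOn 𝓘(ℝ, ℝ × ℝ) 𝓘(ℝ, E) ∞ Λ (strip c d ε))
  (hA : ∀ z ∈ strip c d ε, (⟨Λ z, partialVelocity Λ (strip c d ε) (1, 0) z⟩ :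
    TangentBundle 𝓘(ℝ, E) M) ∈ F.A)
include hcd hε hΛ hA

/-- The pointwise first variation formula at a regular parameter. -/
lemma fderivWithin_lagrangian_partialVelocity {τ : ℝ} (hτ : τ ∈ Ioo c d) :
    fundamentalTensor F.L (velocity (longitudinal Λ 0) τ) (variationField Λ τ)
        (covDerivAlong F (longitudinal Λ 0) (velocity (longitudinal Λ 0))
          (velocity (longitudinal Λ 0)) τ) =
      fderivWithin ℝ (fun z => fundamentalTensor F.L (partialVelocity Λ (strip c d ε) (1, 0) z)
        (partialVelocity Λ (strip c d ε) (0, 1) z) (partialVelocity Λ (strip c d ε) (1, 0) z))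
        (strip c d ε) (τ, 0) (1, 0) -
      (1 / 2) * fderivWithin ℝ (fun z => F.L ⟨Λ z, partialVelocity Λ (strip c d ε) (1, 0) z⟩)
        (strip c d ε) (τ, 0) (0, 1) := by
  have h0 : (0 : ℝ) ∈ Ioo (-ε) ε := ⟨by linarith, hε⟩
  have hz : (τ, (0 : ℝ)) ∈ strip c d ε := ⟨Ioo_subset_Icc_self hτ, h0⟩
  have hS : strip c d ε ∈ 𝓝 (τ, (0 : ℝ)) :=
    prod_mem_nhds (Icc_mem_nhds hτ.1 hτ.2) (isOpen_Ioo.mem_nhds h0)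
  have hEL := fundamentalTensor_covDerivAlong_velocity hcd hΛ hA hε hτ
  set p := Λ (τ, 0)
  have hp : Λ (τ, 0) ∈ (chartAt E p).source := mem_chart_source E p
  set g := extChartAt 𝓘(ℝ, E) p ∘ Λ with hgdef
  have hg : ContDiffAt ℝ ∞ g (τ, 0) := (contDiffWithinAt_extChartAt_comp hΛ hz hp).contDiffAt hS
  have hm := mem_chartDomain_partialVelocity hcd hΛ hA hz hp
  rw [← hgdef, fderivWithin_of_mem_nhds hS] at hm
  have hℓ := (contDiffOn_chartLagrangian F p).contDiffAt ((isOpen_chartDomain F p).mem_nhds hm)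
  have hev : ∀ᶠ y in 𝓝 (τ, (0 : ℝ)), Λ y ∈ (chartAt E p).source := by
    have := eventually_mem_chart_source hΛ hz hp
    rwa [nhdsWithin_eq_nhds.2 hS] at this
  have ev₁ : (fun z => F.L ⟨Λ z, partialVelocity Λ (strip c d ε) (1, 0) z⟩) =ᶠ[𝓝 (τ, 0)]
      fun y => chartLagrangian F p (g y, fderiv ℝ g y (1, 0)) := by
    filter_upwards [hev, eventually_mem_nhds_iff.2 hS] with y h1 h2
    rw [lagrangian_partialVelocity_eq hcd hΛ hA (mem_of_mem_nhds h2) h1, ← hgdef,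
      fderivWithin_of_mem_nhds h2]
  have ev₂ : (fun z => fundamentalTensor F.L (partialVelocity Λ (strip c d ε) (1, 0) z)
        (partialVelocity Λ (strip c d ε) (0, 1) z)
        (partialVelocity Λ (strip c d ε) (1, 0) z)) =ᶠ[𝓝 (τ, 0)]
      fun y => (1 / 2) * fderiv ℝ (chartLagrangian F p) (g y, fderiv ℝ g y (1, 0))
        (0, fderiv ℝ g y (0, 1)) := by
    filter_upwards [hev, eventually_mem_nhds_iff.2 hS] with y h1 h2
    rw [fundamentalTensor_partialVelocity_eq hcd hΛ hA (mem_of_mem_nhds h2) h1, ← hgdef,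
      fderivWithin_of_mem_nhds h2]
  have hdg : DifferentiableAt ℝ (fderiv ℝ g) (τ, 0) :=
    (contDiffAt_fderiv hg).differentiableAt (by simp)
  have hdiff : DifferentiableAt ℝ (fun y => fderiv ℝ (chartLagrangian F p)
      (g y, fderiv ℝ g y (1, 0)) (0, fderiv ℝ g y (0, 1))) (τ, 0) := by
    have h1 : DifferentiableAt ℝ (fun y => (g y, fderiv ℝ g y (1, 0))) (τ, 0) :=
      (hg.differentiableAt (by simp)).prodMk (hdg.clm_apply (differentiableAt_const _))
    have h2 : DifferentiableAt ℝ (fun y => fderiv ℝ (chartLagrangian F p)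
        (g y, fderiv ℝ g y (1, 0))) (τ, 0) :=
      DifferentiableAt.comp (τ, (0 : ℝ)) (f := fun y => (g y, fderiv ℝ g y (1, 0)))
        ((contDiffAt_fderiv hℓ).differentiableAt (by simp)) h1
    exact h2.clm_apply ((differentiableAt_const (0 : E)).prodMk
      (hdg.clm_apply (differentiableAt_const _)))
  rw [fderivWithin_of_mem_nhds hS, fderivWithin_of_mem_nhds hS, ev₁.fderiv_eq, ev₂.fderiv_eq,
    fderiv_const_mul hdiff, smul_apply, smul_eq_mul, fderiv_lagrangian_variation hg hℓ]
  refine hEL.trans ?_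
  ring

/-- First variation formula on a strip on which the variation is smooth. -/
lemma hasDerivAt_energy_strip :
    (∀ s ∈ Ioo (-ε) ε, IntervalIntegrable
      (fun τ => F.L ⟨longitudinal Λ s τ, velocity (longitudinal Λ s) τ⟩) volume c d) ∧
    IntervalIntegrable (fun τ => fundamentalTensor F.L (velocity (longitudinal Λ 0) τ)
      (variationField Λ τ) (covDerivAlong F (longitudinal Λ 0) (velocity (longitudinal Λ 0))
        (velocity (longitudinal Λ 0)) τ)) volume c d ∧
    HasDerivAt (fun s => energy F c d (longitudinal Λ s))
      (-(∫ τ in c..d, fundamentalTensor F.L (velocity (longitudinal Λ 0) τ)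
        (variationField Λ τ) (covDerivAlong F (longitudinal Λ 0) (velocity (longitudinal Λ 0))
          (velocity (longitudinal Λ 0)) τ)) +
        (fundamentalTensor F.L (leftVelocity (longitudinal Λ 0) d) (variationField Λ d)
            (leftVelocity (longitudinal Λ 0) d) -
          fundamentalTensor F.L (rightVelocity (longitudinal Λ 0) c) (variationField Λ c)
            (rightVelocity (longitudinal Λ 0) c))) 0 := by
  have h0 : (0 : ℝ) ∈ Ioo (-ε) ε := ⟨by linarith, hε⟩
  have hf := contDiffOn_lagrangian_partialVelocity hcd hΛ hA
  have hβ := contDiffOn_fundamentalTensor_partialVelocity hcd hΛ hA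
  have hfd := intervalIntegrable_slice hcd (contDiffOn_fderivWithin_strip hcd hf (0, 1)) h0
  have hβd := intervalIntegrable_slice hcd (contDiffOn_fderivWithin_strip hcd hβ (1, 0)) h0
  have hvel : ∀ s ∈ Ioo (-ε) ε, EqOn
      (fun τ => F.L ⟨Λ (τ, s), partialVelocity Λ (strip c d ε) (1, 0) (τ, s)⟩)
      (fun τ => F.L ⟨longitudinal Λ s τ, velocity (longitudinal Λ s) τ⟩) (Ioo c d) := by
    intro s hs τ hτ
    simp only [velocity_eq hΛ hτ hs]
  -- Equality on the open interval is all that holds and all that the integrals see: the endpoints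
  -- are null, and the velocity there may be a default value.
  have hpt : EqOn _ _ (Ioo c d) := fun τ hτ =>
    (fderivWithin_lagrangian_partialVelocity hcd hε hΛ hA hτ).symm
  have hIoo : uIoo c d = Ioo c d := uIoo_of_le hcd.le
  refine ⟨fun s hs => (intervalIntegrable_slice hcd hf hs).congr_uIoo (by
    rw [hIoo]; exact hvel s hs), (hβd.sub (hfd.const_mul (1 / 2))).congr_uIoo (by
    rw [hIoo]; exact hpt), ?_⟩
  rw [← intervalIntegral.integral_congr_Ioo_of_le hcd.le hpt,
    intervalIntegral.integral_sub hβd (hfd.const_mul (1 / 2)),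
    intervalIntegral.integral_const_mul, integral_fderivWithin_strip hcd hε hβ,
    leftVelocity_eq hΛ (right_mem_Ioc.2 hcd) h0, rightVelocity_eq hΛ (left_mem_Ico.2 hcd) h0,
    variationField_eq hΛ (right_mem_Icc.2 hcd.le) hε,
    variationField_eq hΛ (left_mem_Icc.2 hcd.le) hε]
  have hmain := (hasDerivAt_integral_strip hcd hε hf).const_mul (1 / 2)
  have ev : (fun s => energy F c d (longitudinal Λ s)) =ᶠ[𝓝 0] fun s =>
      (1 / 2) * ∫ τ in c..d, F.L ⟨Λ (τ, s), partialVelocity Λ (strip c d ε) (1, 0) (τ, s)⟩ := by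
    filter_upwards [isOpen_Ioo.mem_nhds h0] with s hs
    rw [energy, intervalIntegral.integral_congr_Ioo_of_le hcd.le (hvel s hs)]
  refine (hmain.congr_of_eventuallyEq ev).congr_deriv ?_
  ring

end Strip

/-- The strip is closed in τ, so one-sided admissibility is needed: the right velocity serves for τ
< d, the left one for τ = d. -/
lemma partialVelocity_mem {a b c d ε : ℝ} {Λ : ℝ × ℝ → M} (hac : a ≤ c) (hcd : c < d) (hdb : d ≤ b)
    (hΛ : ContMDiffOn 𝓘(ℝ, ℝ × ℝ) 𝓘(ℝ, E) ∞ Λ (strip c d ε))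
    (hadm : ∀ s ∈ Ioo (-ε) ε, IsAdmissibleCurve F a b (longitudinal Λ s)) :
    ∀ z ∈ strip c d ε, (⟨Λ z, partialVelocity Λ (strip c d ε) (1, 0) z⟩ :
      TangentBundle 𝓘(ℝ, E) M) ∈ F.A := by
  rintro ⟨τ, s⟩ ⟨hτ, hs⟩
  rcases hτ.2.lt_or_eq with h | h
  · have := (hadm s hs).1 τ ⟨hac.trans hτ.1, h.trans_le hdb⟩
    rwa [rightVelocity_eq hΛ ⟨hτ.1, h⟩ hs] at this
  · have hc : c < τ := by simp only at h; rwa [h]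
    have := (hadm s hs).2 τ ⟨hac.trans_lt hc, hτ.2.trans hdb⟩
    rwa [leftVelocity_eq hΛ ⟨hc, hτ.2⟩ hs] at this

end PseudoFinsler

end

open PseudoFinsler in
/-- First variation formula for the energy of a pseudo-Finsler metric. The base curve of the
variation `Λ` is `γ = γ_0 = longitudinal Λ 0`. -/
theorem proposition3p1 {E : Type*} [NormedAddCommGroup E] [NormedSpace ℝ E] [FiniteDimensional ℝ E]
    {M : Type*} [TopologicalSpace M] [ChartedSpace E M] [IsManifold 𝓘(ℝ, E) ∞ M]
    (F : PseudoFinslerMetric E M) {a b ε : ℝ} {h : ℕ} {t : Fin (h + 2) → ℝ}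
    (Λ : ℝ × ℝ → M) (hΛ : IsPiecewiseSmoothVariation E a b ε t Λ)
    (hadm : ∀ s ∈ Ioo (-ε) ε, IsAdmissibleCurve F a b (longitudinal Λ s)) :
    let γ : ℝ → M := longitudinal Λ 0
    let W : Π τ : ℝ, TangentSpace 𝓘(ℝ, E) (γ τ) := variationField Λ
    (∀ s ∈ Ioo (-ε) ε, IntervalIntegrable
      (fun τ => F.L ⟨longitudinal Λ s τ, velocity (longitudinal Λ s) τ⟩) volume a b) ∧
    IntervalIntegrable (fun τ => fundamentalTensor F.L (velocity γ τ) (W τ)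
      (covDerivAlong F γ (velocity γ) (velocity γ) τ)) volume a b ∧
    HasDerivAt (fun s : ℝ => energy F a b (longitudinal Λ s))
      (-(∫ τ in a..b, fundamentalTensor F.L (velocity γ τ) (W τ)
            (covDerivAlong F γ (velocity γ) (velocity γ) τ)) +
        (fundamentalTensor F.L (leftVelocity γ b) (W b) (leftVelocity γ b) -
          fundamentalTensor F.L (rightVelocity γ a) (W a) (rightVelocity γ a)) +
        ∑ i : Fin h,
          (legendre F (leftVelocity γ (t i.succ.castSucc)) (W (t i.succ.castSucc)) -
            legendre F (rightVelocity γ (t i.succ.castSucc)) (W (t i.succ.castSucc))))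
      0 := by
  intro γ W
  obtain ⟨hε, hmono, rfl, rfl, hsm⟩ := hΛ
  have h0 : (0 : ℝ) ∈ Set.Ioo (-ε) ε := ⟨by linarith, hε⟩
  have hlt : ∀ i : Fin (h + 1), t i.castSucc < t i.succ := fun i => hmono i.castSucc_lt_succ
  have hA := fun i => partialVelocity_mem (hmono.monotone (Fin.zero_le _)) (hlt i)
    (hmono.monotone (Fin.le_last _)) (hsm i) hadm
  have hstrip := fun i => hasDerivAt_energy_strip (hlt i) hε (hsm i) (hA i)
  have hL := fun s hs => integral_partition t fun i => (hstrip i).1 s hs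
  have hD := integral_partition t fun i => (hstrip i).2.1
  refine ⟨fun s hs => (hL s hs).1, hD.1, ?_⟩
  have hsum := HasDerivAt.fun_sum (u := Finset.univ) fun i _ => (hstrip i).2.2
  have ev : (fun s => energy F (t 0) (t (Fin.last (h + 1))) (longitudinal Λ s)) =ᶠ[𝓝 0]
      fun s => ∑ i : Fin (h + 1), energy F (t i.castSucc) (t i.succ) (longitudinal Λ s) := by
    filter_upwards [isOpen_Ioo.mem_nhds h0] with s hs
    simp only [energy]
    rw [← (hL s hs).2, Finset.mul_sum]
  refine (hsum.congr_of_eventuallyEq ev).congr_deriv ?_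
  rw [Finset.sum_add_distrib, Finset.sum_neg_distrib, hD.2, sum_boundary_partition
    (fun i => fundamentalTensor F.L (leftVelocity γ (t i)) (W (t i)) (leftVelocity γ (t i)))
    (fun i => fundamentalTensor F.L (rightVelocity γ (t i)) (W (t i)) (rightVelocity γ (t i)))]
  refine (add_assoc _ _ _).symm.trans (congrArg _ ?_)
  refine Finset.sum_congr rfl fun i _ => ?_
  have hi₀ : t 0 < t i.succ.castSucc := hmono (by simp [Fin.lt_def])
  have hi₁ : t i.succ.castSucc < t (Fin.last (h + 1)) := hmono (Fin.castSucc_lt_last _)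
  -- The Legendre transform has the velocity in the first slot and the strip formula has it in the
  -- last; symmetry of g is available because both one-sided velocities at the break lie in `F.A`.
  rw [legendre, legendre, fundamentalTensor_symm ((hadm 0 h0).2 _ ⟨hi₀, hi₁.le⟩),
    fundamentalTensor_symm ((hadm 0 h0).1 _ ⟨hi₀.le, hi₁⟩)]
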